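/- Notation. For $x,\omega\in\mathbb R$, $a>0$ let $T_xf(t)=f(t-x)$, $M_\omega f(t)=e^{2\pi i\omega t}f(t)$, $D_af(t)=a^{-1/2}f(t/a)$ on $L^2(\mathbb R)$; $\langle\cdot,\cdot\rangle$ is linear in the first entry and $\hat f(\xi)=\int_{\mathbb R} f(t)e^{-2\pi i\xi t}\,dt$ (extended to $L^2$). Fix $0\le\alpha<1$ and put $\beta(\omega)=(1+|\omega|)^{-\alpha}$. For $z=(x,\omega)\in X=\mathbb R^2$ (with Lebesgue measure) put $\pi(\sigma(z))=T_xM_\omega D_{\beta(\omega)}$. For $\psi\in L^2(\mathbb R)\setminus\{0\}$ let $A_\sigma=A_{\sigma,\psi}$ be the operator defined weakly by $A_\sigma f=\int_X\langle f,\pi(\sigma(z))\psi\rangle\,\pi(\sigma(z))\psi\,dz$; $\psi$ is admissible if $A_\sigma$ is bounded and boundedly invertible on $L^2(\mathbb R)$. For admissible $\psi$ put $$V_\psi f(z)=\langle f,\pi(\sigma(z))\psi\rangle,\quad W_\psi f(z)=\langle f,A_\sigma^{-1}\pi(\sigma(z))\psi\rangle,\quad K^\kappa_{\psi,\varphi}(z,z^*)=\langle\pi(\sigma(z))\psi,\,A_\sigma^{-\kappa}\pi(\sigma(z^*))\varphi\rangle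 .$$ For $s\ge0$ let $v_s(x,\omega)=(1+|\omega|)^s$, $w_s(z,z^*)=\max\{v_s(z)/v_s(z^*),v_s(z^*)/v_s(z)\}$, and $L^p_{v_s}=\{F \text{ measurable}: Fv_s\in L^p(X)\}$ with $\|F\|_{L^p_{v_s}}=\|Fv_s\|_{L^p}$. Let $\mathcal H_{1,v_s}^\psi=\{f\in L^2: W_\psi f\in L^1_{v_s}\}$ and $\mathcal K_{1,v_s}^\psi=\{f\in L^2: V_\psi f\in L^1_{v_s}\}$, with norms $\|W_\psi f\|_{L^1_{v_s}}$ and $\|V_\psi f\|_{L^1_{v_s}}$; a prime denotes the space of bounded conjugate linear functionals. When $\pi(\sigma(z))\psi\in\mathcal H^\psi_{1,v_s}$ and $A_\sigma^{-1}\pi(\sigma(z))\psi\in\mathcal K^\psi_{1,v_s}$ for all $z$, the transforms $V_\psi$ and $W_\psi$ extend to $(\mathcal H^\psi_{1,v_s})'$ and $(\mathcal K^\psi_{1,v_s})'$ by duality, and for $1\le p\le\infty$ $$\mathcal H_{p,v_s}^\psi=\{F\in(\mathcal K^\psi_{1,v_s})': W_\psi F\in L^p_{v_s}\},\qquad \mathcal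 K_{p,v_s}^\psi=\{F\in(\mathcal H^\psi_{1,v_s})': V_\psi F\in L^p_{v_s}\},$$ with norms $\|W_\psi F\|_{L^p_{v_s}}$ and $\|V_\psi F\|_{L^p_{v_s}}$. Theorem. Let $0\le\alpha<1$, $s\ge0$ and $$r>\frac{2+2s+7\alpha-4\alpha^2}{2(1-\alpha)^2}.$$ Let $\psi,\varphi\in L^2(\mathbb R)$, $\psi\ne0$, be such that $\hat\psi,\hat\varphi\in C^2(\mathbb R)$ and, for some constant $C$, $|\hat\psi^{(l)}(\xi)|,|\hat\varphi^{(l)}(\xi)|\le C(1+|\xi|)^{-r}$ for $l=0,1,2$ and all $\xi\in\mathbb R$. Then: 1. $\psi$ is admissible, and for $\kappa=0,1,2$ $$\sup_{(x^*,\omega^*)\in\mathbb R^2}\int_{\mathbb R}\int_{\mathbb R}|K^\kappa_{\psi,\varphi}(x,\omega,x^*,\omega^*)|\,w_s(x,\omega,x^*,\omega^*)\,dx\,d\omega<\infty .$$ 2. The fundamental condition of generalized coorbit theory holds: with $\mathcal R(z,z^*)=\langle A_\sigma^{-1}\pi(\sigma(z))\psi,\pi(\sigma(z^*))\psi\rangle$,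 $$\operatorname*{ess\,sup}_{z^*\in X}\int_X|\mathcal R(z,z^*)|\,w_s(z,z^*)\,dz<\infty;$$ moreover $\pi(\sigma(z))\psi\in\mathcal H^\psi_{1,v_s}$ and $A_\sigma^{-1}\pi(\sigma(z))\psi\in\mathcal K^\psi_{1,v_s}$ for all $z\in X$. 3. For all $1\le p\le\infty$, $\mathcal H_{p,v_s}^\psi=\mathcal K_{p,v_s}^\psi$ with equivalent norms. 4. If also $\varphi\ne0$, then for all $1\le p\le\infty$, $\mathcal H_{p,v_s}^\psi=\mathcal H_{p,v_s}^\varphi$ with equivalent norms. -/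

import Mathlib

open MeasureTheory
open scoped ENNReal NNReal FourierTransform

noncomputable section

namespace AlphaMod

/-- The Hilbert space `L²(ℝ)` of complex-valued functions. -/
abbrev L2 : Type := Lp ℂ 2 (volume : Measure ℝ)

/-- The inner product of `L²(ℝ)`, linear in the first and conjugate linear in the second entry. -/
def ip (f g : L2) : ℂ := inner ℂ g f

/-! ### The affine Weyl-Heisenberg group and its Stone-von Neumann representation -/

/-- The affine Weyl-Heisenberg group, with elements `(x, ω, a, τ)`, `a > 0`. -/
@[ext]
structure AffineWH where
  x : ℝ
  ω : ℝ
  a : ℝ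
  τ : ℝ
  a_pos : 0 < a

instance : Mul AffineWH where
  mul g h := ⟨g.x + g.a * h.x, g.ω + 1 / g.a * h.ω, g.a * h.a, g.τ + h.τ + g.ω * g.a * h.x,
    mul_pos g.a_pos h.a_pos⟩

instance : One AffineWH where
  one := ⟨0, 0, 1, 0, one_pos⟩

instance : Inv AffineWH where
  inv g := ⟨-(g.x / g.a), -(g.ω * g.a), 1 / g.a, -g.τ + g.x * g.ω, one_div_pos.2 g.a_pos⟩

instance : Group AffineWH :=
  Group.ofLeftAxioms
    (by
      intro g h k
      have hg := g.a_pos.ne'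
      have hh := h.a_pos.ne'
      apply AffineWH.ext
      · change (g.x + g.a * h.x) + (g.a * h.a) * k.x = g.x + g.a * (h.x + h.a * k.x); ring
      · change (g.ω + 1 / g.a * h.ω) + 1 / (g.a * h.a) * k.ω
          = g.ω + 1 / g.a * (h.ω + 1 / h.a * k.ω)
        field_simp
        ring
      · change g.a * h.a * k.a = g.a * (h.a * k.a); ring
      · change (g.τ + h.τ + g.ω * g.a * h.x) + k.τ + (g.ω + 1 / g.a * h.ω) * (g.a * h.a) * k.x
          = g.τ + (h.τ + k.τ + h.ω * h.a * k.x) + g.ω * g.a * (h.x + h.a * k.x)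
        field_simp
        ring)
    (by
      intro g
      apply AffineWH.ext
      · change 0 + 1 * g.x = g.x; ring
      · change 0 + 1 / 1 * g.ω = g.ω; ring
      · change 1 * g.a = g.a; ring
      · change 0 + g.τ + 0 * 1 * g.x = g.τ; ring)
    (by
      intro g
      have hg := g.a_pos.ne'
      apply AffineWH.ext
      · change -(g.x / g.a) + 1 / g.a * g.x = 0; ring
      · change -(g.ω * g.a) + 1 / (1 / g.a) * g.ω = 0
        field_simp
        ring
      · change 1 / g.a * g.a = 1
        field_simp
      · change (-g.τ + g.x * g.ω) + g.τ + -(g.ω * g.a) * (1 / g.a) * g.x = 0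
        field_simp
        ring)

lemma memLp_translation (x : ℝ) (f : L2) : MemLp (fun t : ℝ => f (t - x)) 2 volume :=
  (Lp.memLp f).comp_measurePreserving (measurePreserving_sub_right volume x)

lemma memLp_modulation (ω : ℝ) (f : L2) :
    MemLp (fun t : ℝ => Complex.exp (2 * Real.pi * Complex.I * ω * t) * f t) 2 volume := by
  refine (Lp.memLp f).of_le ?_ (Filter.Eventually.of_forall fun t => ?_)
  · exact (Continuous.aestronglyMeasurable (by fun_prop)).mul (Lp.aestronglyMeasurable f)
  · rw [norm_mul]
    have h : (2 * Real.pi * Complex.I * ω * t : ℂ) = ((2 * Real.pi * ω * t : ℝ) : ℂ) * Complex.I := by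
      push_cast; ring
    rw [h, Complex.norm_exp_ofReal_mul_I, one_mul]

lemma memLp_dilation (a : ℝ) (ha : 0 < a) (f : L2) :
    MemLp (fun t : ℝ => ((1 / Real.sqrt a : ℝ) : ℂ) * f (t / a)) 2 volume := by
  refine MemLp.const_mul ?_ _
  have h : MemLp (⇑f) 2 (Measure.map (fun t : ℝ => t / a) volume) := by
    simp only [div_eq_mul_inv]
    rw [Real.map_volume_mul_right (inv_ne_zero ha.ne')]
    exact (Lp.memLp f).smul_measure ENNReal.ofReal_ne_top
  exact h.comp_of_map (by fun_prop)

/-- Translation `T_x f(t) = f(t - x)`. -/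
def translation (x : ℝ) (f : L2) : L2 := (memLp_translation x f).toLp _

/-- Modulation `M_ω f(t) = e^{2πiωt} f(t)`. -/
def modulation (ω : ℝ) (f : L2) : L2 := (memLp_modulation ω f).toLp _

/-- Dilation `D_a f(t) = a^{-1/2} f(t/a)`, `a > 0`. -/
def dilation (a : ℝ) (ha : 0 < a) (f : L2) : L2 := (memLp_dilation a ha f).toLp _

/-- The Stone-von Neumann representation `π(x, ω, a, τ) = e^{2πiτ} T_x M_ω D_a` on `L²(ℝ)`. -/
def rep (g : AffineWH) (f : L2) : L2 :=
  Complex.exp (2 * Real.pi * Complex.I * g.τ) •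
    translation g.x (modulation g.ω (dilation g.a g.a_pos f))

/-! ### The section and the frame operator -/

/-- The homogeneous space `G_{aWH} / {(0, 0, a, τ)}`, identified with `ℝ²` with points `(x, ω)`;
its invariant measure is Lebesgue measure `dx dω`. -/
abbrev X : Type := ℝ × ℝ

/-- `β(ω) = (1 + |ω|)^{-α}`. -/
def beta (α ω : ℝ) : ℝ := (1 + |ω|) ^ (-α)

lemma beta_pos (α ω : ℝ) : 0 < beta α ω := Real.rpow_pos_of_pos (by positivity) _

/-- The section `σ(x, ω) = (x, ω, β(ω), 0)`. -/
def sect (α : ℝ) (z : X) : AffineWH := ⟨z.1, z.2, beta α z.2, 0, beta_pos α z.2⟩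

/-- The vectors `π(σ(z))ψ`. -/
def atom (α : ℝ) (ψ : L2) (z : X) : L2 := rep (sect α z) ψ

/-- `A` is the (everywhere defined, bounded) operator given weakly by
`A f = ∫_X ⟨f, π(σ(z))ψ⟩ π(σ(z))ψ dμ(z)`. -/
def IsFrameOperator (α : ℝ) (ψ : L2) (A : L2 →L[ℂ] L2) : Prop :=
  ∀ f h : L2,
    Integrable (fun z : X => ip f (atom α ψ z) * ip (atom α ψ z) h) ∧
    ip (A f) h = ∫ z : X, ip f (atom α ψ z) * ip (atom α ψ z) h

lemma IsFrameOperator.unique {α : ℝ} {ψ : L2} {A B : L2 →L[ℂ] L2}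
    (hA : IsFrameOperator α ψ A) (hB : IsFrameOperator α ψ B) : A = B := by
  ext1 f
  refine ext_inner_left ℂ fun h => ?_
  exact (hA f h).2.trans (hB f h).2.symm

/-- `ψ ≠ 0` is admissible if its frame operator is bounded and boundedly invertible. -/
def Admissible (α : ℝ) (ψ : L2) : Prop :=
  ψ ≠ 0 ∧ ∃ A : L2 →L[ℂ] L2, IsFrameOperator α ψ A ∧ IsUnit A

open Classical in
/-- The frame operator `A_σ` of `ψ` (the value `0` is used only if no bounded one exists). -/
def frameOp (α : ℝ) (ψ : L2) : L2 →L[ℂ] L2 :=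
  if h : ∃ A : L2 →L[ℂ] L2, IsFrameOperator α ψ A then h.choose else 0

lemma frameOp_eq {α : ℝ} {ψ : L2} {A : L2 →L[ℂ] L2} (hA : IsFrameOperator α ψ A) :
    frameOp α ψ = A := by
  have h : ∃ A : L2 →L[ℂ] L2, IsFrameOperator α ψ A := ⟨A, hA⟩
  rw [frameOp, dif_pos h]
  exact h.choose_spec.unique hA

/-- `A_σ^{-1}`; the true inverse whenever `ψ` is admissible. -/
def frameInv (α : ℝ) (ψ : L2) : L2 →L[ℂ] L2 := Ring.inverse (frameOp α ψ)

/-- The vectors `A_σ^{-1} π(σ(z))ψ`. -/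
def dualAtom (α : ℝ) (ψ : L2) (z : X) : L2 := frameInv α ψ (atom α ψ z)

/-! ### Kernels and weights -/

/-- `K^κ_{ψ,φ}(z, z') = ⟨π(σ(z))ψ, A_σ^{-κ} π(σ(z'))φ⟩`, with `A_σ` the frame operator of `ψ`. -/
def kernelK (α : ℝ) (κ : ℕ) (ψ φ : L2) (z z' : X) : ℂ :=
  ip (atom α ψ z) ((frameInv α ψ ^ κ) (atom α φ z'))

/-- The reproducing kernel `R(z, z') = ⟨A_σ^{-1} π(σ(z))ψ, π(σ(z'))ψ⟩`. -/
def kernelR (α : ℝ) (ψ : L2) (z z' : X) : ℂ := ip (dualAtom α ψ z) (atom α ψ z')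

/-- `v_s(x, ω) = (1 + |ω|)^s`. -/
def polyWeight (s : ℝ) (z : X) : ℝ := (1 + |z.2|) ^ s

/-- `w(z, z') = max (v(z)/v(z')) (v(z')/v(z))`. -/
def ratioWeight (v : X → ℝ) (z z' : X) : ℝ := max (v z / v z') (v z' / v z)

/-- The fundamental condition
`ess sup_{z'} ∫_X |R(z, z')| w(z, z') dμ(z) < ∞`. -/
def FundamentalCondition (α : ℝ) (ψ : L2) (v : X → ℝ) : Prop :=
  essSup (fun z' : X => ∫⁻ z : X, ‖kernelR α ψ z z'‖ₑ * ENNReal.ofReal (ratioWeight v z z')) volume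
    < ∞

/-! ### Generalized coorbit spaces -/

/-- The norm of `L^p_v(X)`. -/
def wNorm (p : ℝ≥0∞) (v : X → ℝ) (F : X → ℂ) : ℝ≥0∞ :=
  eLpNorm (fun z => F z * (v z : ℂ)) p volume

/-- Membership in `L^p_v(X)`. -/
def MemLpv (p : ℝ≥0∞) (v : X → ℝ) (F : X → ℂ) : Prop :=
  MemLp (fun z => F z * (v z : ℂ)) p volume

/-- For a family `e` of vectors, the subspace of all `f ∈ L²(ℝ)` with `⟨f, e(·)⟩ ∈ L^1_v(X)`. -/
def reservoir (v : X → ℝ) (e : X → L2) : Submodule ℂ L2 where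
  carrier := {f | MemLpv 1 v fun z => ip f (e z)}
  add_mem' {f g} hf hg := by
    have h := MemLp.add hf hg
    refine MemLp.ae_eq (Filter.Eventually.of_forall fun z => ?_) h
    simp only [Pi.add_apply, ip, inner_add_right]
    ring
  zero_mem' := by
    simp only [Set.mem_ofPred_eq, MemLpv, ip, inner_zero_right, zero_mul]
    exact MemLp.zero'
  smul_mem' c f hf := by
    have h := MemLp.const_mul hf c
    refine MemLp.ae_eq (Filter.Eventually.of_forall fun z => ?_) h
    simp only [ip, inner_smul_right]
    ring

/-- `H_{1,v} = {f ∈ L² : W_ψ f ∈ L^1_v}`, where `W_ψ f(z) = ⟨f, A_σ^{-1} π(σ(z))ψ⟩`. -/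
def spaceH1 (α : ℝ) (ψ : L2) (v : X → ℝ) : Submodule ℂ L2 := reservoir v (dualAtom α ψ)

/-- `K_{1,v} = {f ∈ L² : V_ψ f ∈ L^1_v}`, where `V_ψ f(z) = ⟨f, π(σ(z))ψ⟩`. -/
def spaceK1 (α : ℝ) (ψ : L2) (v : X → ℝ) : Submodule ℂ L2 := reservoir v (atom α ψ)

/-- A conjugate linear functional on a subspace of `L²(ℝ)`. -/
structure AntiFunctional where
  domain : Submodule ℂ L2
  toFun : domain →ₛₗ[starRingEnd ℂ] ℂ

open Classical in
/-- The pairing `⟨F, u⟩`, for `u` in the domain of `F`. -/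
def AntiFunctional.pair (F : AntiFunctional) (u : L2) : ℂ :=
  if h : u ∈ F.domain then F.toFun ⟨u, h⟩ else 0

/-- The anti-dual of `reservoir v e` with its norm `f ↦ ‖⟨f, e(·)⟩‖_{L^1_v}`: all bounded
conjugate linear functionals on this space. -/
def antiDual (v : X → ℝ) (e : X → L2) : Set AntiFunctional :=
  {F | F.domain = reservoir v e ∧
    ∃ C : ℝ, ∀ u : F.domain, ‖F.toFun u‖ ≤ C * (wNorm 1 v fun z => ip (u : L2) (e z)).toReal}

/-- The extended transform `V_ψ F(z) = ⟨F, π(σ(z))ψ⟩`. -/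
def extV (α : ℝ) (ψ : L2) (F : AntiFunctional) (z : X) : ℂ := F.pair (atom α ψ z)

/-- The extended transform `W_ψ F(z) = ⟨F, A_σ^{-1} π(σ(z))ψ⟩`. -/
def extW (α : ℝ) (ψ : L2) (F : AntiFunctional) (z : X) : ℂ := F.pair (dualAtom α ψ z)

/-- `H_{p,v} = {F ∈ K_{1,v}' : W_ψ F ∈ L^p_v}`, normed by `‖W_ψ F‖_{L^p_v}`. -/
def spaceH (α : ℝ) (ψ : L2) (p : ℝ≥0∞) (v : X → ℝ) : Set AntiFunctional :=
  {F | F ∈ antiDual v (atom α ψ) ∧ MemLpv p v (extW α ψ F)}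

/-- `K_{p,v} = {F ∈ H_{1,v}' : V_ψ F ∈ L^p_v}`, normed by `‖V_ψ F‖_{L^p_v}`. -/
def spaceK (α : ℝ) (ψ : L2) (p : ℝ≥0∞) (v : X → ℝ) : Set AntiFunctional :=
  {F | F ∈ antiDual v (dualAtom α ψ) ∧ MemLpv p v (extV α ψ F)}

/-- Two norms are equivalent on the set `S`. -/
def EquivNormsOn (S : Set AntiFunctional) (N N' : AntiFunctional → ℝ≥0∞) : Prop :=
  ∃ C : ℝ≥0, ∀ F ∈ S, N F ≤ C * N' F ∧ N' F ≤ C * N F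

/-! ### The class of windows -/

/-- `ψ̂` is of class `C²` (has a `C²` representative `g`) and
`|ψ̂^{(l)}(ξ)| ≤ C (1 + |ξ|)^{-r}` for `l = 0, 1, 2`. -/
def FourierDecay (r : ℝ) (ψ : L2) : Prop :=
  ∃ g : ℝ → ℂ, ContDiff ℝ 2 g ∧ (⇑(𝓕 ψ : L2) =ᵐ[volume] g) ∧
    ∃ C : ℝ, ∀ l : ℕ, l ≤ 2 → ∀ ξ : ℝ, ‖iteratedDeriv l g ξ‖ ≤ C * (1 + |ξ|) ^ (-r)

end AlphaMod

end

open AlphaMod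

/-!
On the Fourier side the vectors `π(σ(x, ω))ψ` are molecules `e^{-2πixξ} P(ω, ξ)`: in the metric on
the frequency axis that is obtained by straightening with a primitive of `β`, all profiles `P(ω, ·)`
are localized equally well at `ω`, and a derivative in `ξ` costs only a factor `β(ω)`.

The operator `A_σ` is the Fourier multiplier with the symbol `∫ |P(ω, ξ)|² dω`, which is bounded
above and below and varies slowly at the scale of the frequency covering. Hence `A_σ⁻¹` is a
multiplier of the same kind, and it maps molecules to molecules, of an order lower by `α / (1 - α)`.
All the kernels in question are thus cross kernels of two families of molecules. One integration by
parts in `ξ` bounds them by the product of a decay in `x - x'` at the scale of the common bandwidth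
and a decay in the warped distance of `ω` and `ω'`, so that they satisfy the hypothesis of Schur's
test with the weight `w_s` as soon as the orders are large enough.

For two frames of molecules, the reproducing formula `F(u) = ∫ F(e(y)) ⟨d(y), u⟩ dy`, which extends
from `L²` to the functionals on the reservoirs, then passes from one voice transform to the other by
a Schur bounded kernel, and all the coorbit spaces agree.
-/

namespace AlphaMod

open scoped BoundedContinuousFunction

lemma eLpNorm_two_le_ofReal_sqrt {Ω F : Type*} [MeasurableSpace Ω] {μ : Measure Ω}
    [NormedAddCommGroup F] {f : Ω → F} {M : ℝ} (hM : 0 ≤ M)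
    (h : ∫⁻ x, ‖f x‖ₑ ^ 2 ∂μ ≤ ENNReal.ofReal M) : eLpNorm f 2 μ ≤ ENNReal.ofReal √M := by
  rw [eLpNorm_eq_lintegral_rpow_enorm_toReal (by norm_num) (by norm_num), Real.sqrt_eq_rpow,
    ← ENNReal.ofReal_rpow_of_nonneg hM (by norm_num)]
  simpa using ENNReal.rpow_le_rpow h (by norm_num : (0 : ℝ) ≤ 1 / 2)

section Fourier

open scoped SchwartzMap ContDiff

variable {V F : Type*} [NormedAddCommGroup V] [InnerProductSpace ℝ V] [NormedAddCommGroup F]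
  [InnerProductSpace ℂ F]

lemma continuous_neg_innerₗ : Continuous fun p : V × V => (-innerₗ V) p.1 p.2 :=
  (continuous_inner (𝕜 := ℝ)).neg

variable [FiniteDimensional ℝ V] [MeasurableSpace V] [BorelSpace V]

lemma continuous_fourierInv {f : V → F} (hf : Integrable f) : Continuous (𝓕⁻ f) :=
  VectorFourier.fourierIntegral_continuous Real.continuous_fourierChar
    continuous_neg_innerₗ hf

lemma fourier_eq_fourierInv_comp_neg (f : V → F) : 𝓕 f = 𝓕⁻ f ∘ Neg.neg :=
  funext fun x => by simp [Real.fourierInv_eq_fourier_neg]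

lemma continuous_fourier {f : V → F} (hf : Integrable f) : Continuous (𝓕 f) := by
  rw [fourier_eq_fourierInv_comp_neg]
  exact (continuous_fourierInv hf).comp continuous_neg

lemma norm_mul_norm_fourier_le {G : ℝ → F} (hd : Differentiable ℝ G) (h1 : Integrable G)
    (h1' : Integrable (deriv G)) (x : ℝ) : |x| * ‖𝓕 G x‖ ≤ ‖𝓕 (deriv G) x‖ := by
  rw [Real.fourier_deriv h1 hd h1', norm_smul]
  simp only [norm_mul, Complex.norm_real, Complex.norm_I, Complex.norm_ofNat, Real.norm_eq_abs,
    abs_of_pos Real.pi_pos, mul_one]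
  nlinarith [Real.pi_gt_three, mul_nonneg (abs_nonneg x) (norm_nonneg (𝓕 G x))]

variable [CompleteSpace F]

lemma integral_fourierInv_smul_eq {f : V → ℂ} {g : V → F} (hf : Integrable f)
    (hg : Integrable g) : ∫ ξ, 𝓕⁻ f ξ • g ξ = ∫ x, f x • 𝓕⁻ g x := by
  have h := VectorFourier.integral_fourierIntegral_smul_eq_flip (L := -innerₗ V) (μ := volume)
    (ν := volume) Real.continuous_fourierChar continuous_neg_innerₗ hf hg
  rwa [show (-innerₗ V).flip = -innerₗ V by ext; simp [real_inner_comm]] at h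

theorem fourierInv_toLp_ae {f : V → F} (h1 : Integrable f) (h2 : MemLp f 2) :
    ⇑(𝓕⁻ (h2.toLp f) : Lp F 2 (volume : Measure V)) =ᵐ[volume] 𝓕⁻ f := by
  refine ae_eq_of_integral_contDiff_smul_eq ((Lp.memLp _).locallyIntegrable (by norm_num))
    (continuous_fourierInv h1).locallyIntegrable fun g hg hgc => ?_
  have hc : HasCompactSupport (fun x => (g x : ℂ)) := hgc.comp_left (g := ((↑) : ℝ → ℂ)) rfl
  let θ : 𝓢(V, ℂ) := hc.toSchwartzMap (Complex.ofRealCLM.contDiff.comp hg)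
  have hθ (x : V) : θ x = (g x : ℂ) := rfl
  calc ∫ x, g x • (𝓕⁻ (h2.toLp f) : Lp F 2 (volume : Measure V)) x
      = ∫ x, θ x • (𝓕⁻ (h2.toLp f) : Lp F 2 (volume : Measure V)) x := by simp [hθ]
    _ = ∫ x, (𝓕⁻ θ) x • (h2.toLp f) x := by
        have h := congrArg (fun T : 𝓢'(V, F) => T θ)
          (Lp.fourierInv_toTemperedDistribution_eq (h2.toLp f))
        simpa only [TemperedDistribution.fourierInv_apply, Lp.toTemperedDistribution_apply]
          using h.symm
    _ = ∫ x, 𝓕⁻ (⇑θ) x • f x := by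
        refine integral_congr_ae ?_
        filter_upwards [h2.coeFn_toLp] with x hx
        rw [hx, SchwartzMap.fourierInv_coe]
    _ = ∫ x, g x • 𝓕⁻ f x := by
        rw [integral_fourierInv_smul_eq θ.integrable h1]
        simp [hθ]

theorem eLpNorm_fourierInv_eq {f : V → F} (h1 : Integrable f) (h2 : MemLp f 2) :
    eLpNorm (𝓕⁻ f) 2 = eLpNorm f 2 := by
  rw [← eLpNorm_congr_ae (fourierInv_toLp_ae h1 h2), ← eLpNorm_congr_ae h2.coeFn_toLp,
    ← Lp.enorm_def, ← Lp.enorm_def, ← ofReal_norm, ← ofReal_norm, ← Lp.norm_fourier_eq,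
    FourierTransform.fourier_fourierInv_eq]

theorem eLpNorm_fourier_eq {f : V → F} (h1 : Integrable f) (h2 : MemLp f 2) :
    eLpNorm (𝓕 f) 2 = eLpNorm f 2 := by
  rw [fourier_eq_fourierInv_comp_neg, eLpNorm_comp_measurePreserving
    (continuous_fourierInv h1).aestronglyMeasurable (Measure.measurePreserving_neg volume),
    eLpNorm_fourierInv_eq h1 h2]

theorem integral_inner_fourierInv_eq {f g : V → F} (hf1 : Integrable f) (hf2 : MemLp f 2)
    (hg1 : Integrable g) (hg2 : MemLp g 2) :
    ∫ x, inner ℂ (𝓕⁻ f x) (𝓕⁻ g x) = ∫ ξ, inner ℂ (f ξ) (g ξ) := by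
  have h := Lp.inner_fourier_eq (𝓕⁻ (hf2.toLp f)) (𝓕⁻ (hg2.toLp g))
  rw [FourierTransform.fourier_fourierInv_eq, FourierTransform.fourier_fourierInv_eq,
    L2.inner_def, L2.inner_def] at h
  calc _ = _ := integral_congr_ae ?_
    _ = _ := h.symm
    _ = _ := integral_congr_ae ?_
  · filter_upwards [fourierInv_toLp_ae hf1 hf2, fourierInv_toLp_ae hg1 hg2] with x h1 h2
    rw [h1, h2]
  · filter_upwards [hf2.coeFn_toLp, hg2.coeFn_toLp] with x h1 h2
    rw [h1, h2]

lemma eLpNorm_inv_sqrt_one_add_div_sq_le {l : ℝ} (hl : 0 < l) :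
    eLpNorm (fun x : ℝ => √(1 + (x / l) ^ 2))⁻¹ 2 ≤ ENNReal.ofReal √(Real.pi * l) := by
  have h (x : ℝ) : ‖(√(1 + (x / l) ^ 2))⁻¹‖ₑ ^ 2 = ENNReal.ofReal ((1 + (x / l) ^ 2)⁻¹) := by
    rw [← ofReal_norm, ← ENNReal.ofReal_pow (norm_nonneg _), norm_inv, inv_pow, Real.norm_eq_abs,
      sq_abs, Real.sq_sqrt (by positivity)]
  refine eLpNorm_two_le_ofReal_sqrt (by positivity) (le_of_eq ?_)
  simp_rw [Pi.inv_apply, h]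
  rw [← ofReal_integral_eq_lintegral_ofReal (integrable_inv_one_add_sq.comp_div hl.ne')
    (.of_forall fun x => by positivity), Measure.integral_comp_div (fun x : ℝ => (1 + x ^ 2)⁻¹),
    integral_univ_inv_one_add_sq, abs_of_pos hl, smul_eq_mul, mul_comm]

lemma eLpNorm_sqrt_one_add_div_sq_mul_norm_fourier_le {G : ℝ → F} (hd : Differentiable ℝ G)
    (h1 : Integrable G) (h1' : Integrable (deriv G)) (h2 : MemLp G 2) (h2' : MemLp (deriv G) 2)
    {l : ℝ} (hl : 0 < l) :
    eLpNorm ((fun x : ℝ => √(1 + (x / l) ^ 2)) * fun x => ‖𝓕 G x‖) 2 ≤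
      eLpNorm G 2 + ENNReal.ofReal l⁻¹ * eLpNorm (deriv G) 2 := by
  have hw (x : ℝ) : √(1 + (x / l) ^ 2) ≤ 1 + l⁻¹ * |x| := by
    refine Real.sqrt_le_iff.2 ⟨by positivity, ?_⟩
    rw [div_pow, ← sq_abs x, div_eq_inv_mul, ← inv_pow, ← mul_pow]
    nlinarith [mul_nonneg (inv_nonneg.2 hl.le) (abs_nonneg x)]
  have hle (x : ℝ) :
      ‖√(1 + (x / l) ^ 2) * ‖𝓕 G x‖‖ ≤ ‖𝓕 G x‖ + l⁻¹ * ‖𝓕 (deriv G) x‖ := by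
    rw [norm_mul, norm_norm, Real.norm_of_nonneg (Real.sqrt_nonneg _)]
    calc √(1 + (x / l) ^ 2) * ‖𝓕 G x‖ ≤ (1 + l⁻¹ * |x|) * ‖𝓕 G x‖ := by gcongr; exact hw x
      _ = ‖𝓕 G x‖ + l⁻¹ * (|x| * ‖𝓕 G x‖) := by ring
      _ ≤ ‖𝓕 G x‖ + l⁻¹ * ‖𝓕 (deriv G) x‖ := by
        gcongr; exact norm_mul_norm_fourier_le hd h1 h1' x
  refine (eLpNorm_mono_real hle).trans ((eLpNorm_add_le
    (continuous_fourier h1).aestronglyMeasurable.norm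
    ((continuous_fourier h1').aestronglyMeasurable.norm.const_mul _) (by norm_num)).trans_eq ?_)
  have hsmul := eLpNorm_const_smul l⁻¹ (fun x => ‖𝓕 (deriv G) x‖) 2 volume
  rw [eLpNorm_norm, eLpNorm_fourier_eq h1' h2', Real.enorm_of_nonneg (inv_nonneg.2 hl.le)] at hsmul
  rw [eLpNorm_norm, eLpNorm_fourier_eq h1 h2]
  exact congrArg (_ + ·) hsmul

theorem eLpNorm_one_fourier_le {G : ℝ → F} (hd : Differentiable ℝ G) (h1 : Integrable G)
    (h1' : Integrable (deriv G)) (h2 : MemLp G 2) (h2' : MemLp (deriv G) 2) {l : ℝ}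
    (hl : 0 < l) : eLpNorm (𝓕 G) 1 ≤
      ENNReal.ofReal √(Real.pi * l) *
        (eLpNorm G 2 + ENNReal.ofReal l⁻¹ * eLpNorm (deriv G) 2) := by
  have hw (x : ℝ) : √(1 + (x / l) ^ 2) ≠ 0 := (Real.sqrt_pos.2 (by positivity)).ne'
  have hw_cont : Continuous fun x : ℝ => √(1 + (x / l) ^ 2) := by fun_prop
  have hmul := eLpNorm_smul_le_mul_eLpNorm (p := 2) (q := 2) (r := 1) (μ := volume)
    (hw_cont.aestronglyMeasurable.mul (continuous_fourier h1).aestronglyMeasurable.norm)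
    (hw_cont.inv₀ hw).aestronglyMeasurable
  have hcancel : (fun x : ℝ => √(1 + (x / l) ^ 2))⁻¹ •
      ((fun x : ℝ => √(1 + (x / l) ^ 2)) * fun x => ‖𝓕 G x‖) = fun x => ‖𝓕 G x‖ :=
    funext fun x => inv_mul_cancel_left₀ (hw x) _
  rw [hcancel, eLpNorm_norm] at hmul
  exact hmul.trans (mul_le_mul' (eLpNorm_inv_sqrt_one_add_div_sq_le hl)
    (eLpNorm_sqrt_one_add_div_sq_mul_norm_fourier_le hd h1 h1' h2 h2' hl))

end Fourier

lemma ip_fourier (f g : L2) : ip (𝓕 f) (𝓕 g) = ip f g := Lp.inner_fourier_eq g f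

section Warp

variable {α : ℝ}

lemma continuous_beta (α : ℝ) : Continuous (beta α) :=
  (by fun_prop : Continuous fun ω : ℝ => 1 + |ω|).rpow_const fun ω => Or.inl (by positivity)

lemma beta_neg (α ω : ℝ) : beta α (-ω) = beta α ω := by rw [beta, beta, abs_neg]

lemma beta_le_one (hα0 : 0 ≤ α) (ω : ℝ) : beta α ω ≤ 1 :=
  Real.rpow_le_one_of_one_le_of_nonpos (by linarith [abs_nonneg ω]) (by linarith)

/-- The primitive of `β`. The vectors `π(σ(x, ω))ψ` have the bandwidth `1 / β(ω)`, so that in the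
warped frequency scale all of them are localized equally well. -/
noncomputable def warp (α ω : ℝ) : ℝ := ∫ t in (0 : ℝ)..ω, beta α t

lemma hasDerivAt_warp (α ω : ℝ) : HasDerivAt (warp α) (beta α ω) ω :=
  (continuous_beta α).integral_hasStrictDerivAt 0 ω |>.hasDerivAt

lemma continuous_warp (α : ℝ) : Continuous (warp α) :=
  continuous_iff_continuousAt.2 fun ω => (hasDerivAt_warp α ω).continuousAt

lemma warp_strictMono (α : ℝ) : StrictMono (warp α) :=
  strictMono_of_deriv_pos fun ω => by rw [(hasDerivAt_warp α ω).deriv]; exact beta_pos α ω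

lemma warp_neg (α ω : ℝ) : warp α (-ω) = -warp α ω := by
  have h := intervalIntegral.integral_comp_neg (a := 0) (b := -ω) (beta α)
  simp only [beta_neg, neg_zero, neg_neg] at h
  rw [warp, h, intervalIntegral.integral_symm, warp]

lemma warp_of_nonneg (hα1 : α < 1) {ω : ℝ} (hω : 0 ≤ ω) :
    warp α ω = ((1 + ω) ^ (1 - α) - 1) / (1 - α) := by
  have h : warp α ω = ∫ t in (0 : ℝ)..ω, (1 + t) ^ (-α) :=
    intervalIntegral.integral_congr fun t ht => by
      rw [Set.uIcc_of_le hω] at ht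
      simp only [beta, abs_of_nonneg ht.1]
  rw [h, intervalIntegral.integral_comp_add_left fun t : ℝ => t ^ (-α),
    integral_rpow (Or.inl (by linarith))]
  simp [neg_add_eq_sub]

lemma abs_warp (hα1 : α < 1) (ω : ℝ) : |warp α ω| = ((1 + |ω|) ^ (1 - α) - 1) / (1 - α) := by
  have h : |warp α ω| = |warp α (|ω|)| := by
    rcases abs_choice ω with h | h <;> simp only [h, warp_neg, abs_neg]
  have h1 : 1 ≤ (1 + |ω|) ^ (1 - α) :=
    Real.one_le_rpow (by linarith [abs_nonneg ω]) (by linarith)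
  rw [h, warp_of_nonneg hα1 (abs_nonneg ω), abs_of_nonneg]
  exact div_nonneg (by linarith) (by linarith)

lemma abs_rpow_sub_rpow_le {a A B : ℝ} (ha0 : 0 ≤ a) (ha1 : a ≤ 1) (hA : 0 < A) (hB : 0 < B) :
    |A ^ a - B ^ a| ≤ A ^ (a - 1) * |A - B| := by
  have e {A : ℝ} (hA : 0 < A) : A ^ a = A ^ (a - 1) * A := by
    rw [Real.rpow_sub_one hA.ne', div_mul_cancel₀ _ hA.ne']
  rcases le_total A B with h | h
  · have h1 : B ^ (a - 1) * B ≤ A ^ (a - 1) * B :=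
      mul_le_mul_of_nonneg_right (Real.rpow_le_rpow_of_nonpos hA h (by linarith)) hB.le
    rw [abs_of_nonpos (by linarith : A - B ≤ 0),
      abs_of_nonpos (by linarith [Real.rpow_le_rpow hA.le h ha0]), e hA, e hB]
    linarith
  · have h1 : A ^ (a - 1) * B ≤ B ^ (a - 1) * B :=
      mul_le_mul_of_nonneg_right (Real.rpow_le_rpow_of_nonpos hB h (by linarith)) hB.le
    rw [abs_of_nonneg (by linarith : 0 ≤ A - B),
      abs_of_nonneg (by linarith [Real.rpow_le_rpow hB.le h ha0]), e hA, e hB]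
    linarith

lemma abs_warp_sub_warp_le_of_nonneg (hα0 : 0 ≤ α) (hα1 : α < 1) {ω ξ : ℝ} (hω : 0 ≤ ω)
    (hξ : 0 ≤ ξ) : |warp α ω - warp α ξ| ≤ beta α ω * |ω - ξ| / (1 - α) := by
  have h := abs_rpow_sub_rpow_le (a := 1 - α) (A := 1 + ω) (B := 1 + ξ)
    (by linarith) (by linarith) (by linarith) (by linarith)
  rw [show 1 - α - 1 = -α by ring, add_sub_add_left_eq_sub] at h
  rw [warp_of_nonneg hα1 hω, warp_of_nonneg hα1 hξ, ← sub_div, sub_sub_sub_cancel_right, abs_div,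
    abs_of_pos (by linarith : 0 < 1 - α), beta, abs_of_nonneg hω]
  gcongr

lemma abs_warp_sub_warp_le (hα0 : 0 ≤ α) (hα1 : α < 1) (ω ξ : ℝ) :
    |warp α ω - warp α ξ| ≤ 3 / (1 - α) * (beta α ω * |ω - ξ|) := by
  wlog hω : 0 ≤ ω generalizing ω ξ
  · have h := this (-ω) (-ξ) (by linarith)
    rw [warp_neg, warp_neg, beta_neg] at h
    simpa only [neg_sub_neg, abs_sub_comm] using h
  have : 0 < 1 - α := by linarith
  have hβ := beta_pos α ω
  rcases le_or_gt 0 ξ with hξ | hξ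
  · calc _ ≤ 1 / (1 - α) * (beta α ω * |ω - ξ|) := by
          rw [one_div_mul_eq_div]; exact abs_warp_sub_warp_le_of_nonneg hα0 hα1 hω hξ
      _ ≤ _ := by gcongr; norm_num
  · have h0 : |warp α ω| ≤ beta α ω * |ω - ξ| / (1 - α) := by
      have := abs_warp_sub_warp_le_of_nonneg hα0 hα1 hω le_rfl
      rw [show warp α 0 = 0 by simp [warp], sub_zero] at this
      refine this.trans ?_
      gcongr 2
      rw [abs_of_nonneg (by linarith), abs_of_nonneg (by linarith)]
      linarith
    have h1 : |warp α ω - warp α (-ξ)| ≤ beta α ω * |ω - ξ| / (1 - α) := by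
      refine (abs_warp_sub_warp_le_of_nonneg hα0 hα1 hω (by linarith)).trans ?_
      gcongr 2
      rw [abs_of_pos (by linarith : 0 < ω - ξ)]
      exact abs_le.2 ⟨by linarith, by linarith⟩
    rw [warp_neg] at h1
    calc |warp α ω - warp α ξ| ≤ 2 * |warp α ω| + |warp α ω - -warp α ξ| := by
          grind [abs_le]
      _ ≤ _ := by rw [div_mul_eq_mul_div, mul_div_assoc]; linarith

/-- One plus the distance of two frequencies in the warped scale. -/
noncomputable def wdist (α ω ξ : ℝ) : ℝ := 1 + |warp α ω - warp α ξ|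

lemma one_le_wdist (α ω ξ : ℝ) : 1 ≤ wdist α ω ξ := le_add_of_nonneg_right (abs_nonneg _)

lemma wdist_pos (α ω ξ : ℝ) : 0 < wdist α ω ξ := one_pos.trans_le (one_le_wdist α ω ξ)

lemma wdist_rpow_nonneg (α ω ξ N : ℝ) : 0 ≤ wdist α ω ξ ^ N :=
  Real.rpow_nonneg (wdist_pos α ω ξ).le N

lemma wdist_comm (α ω ξ : ℝ) : wdist α ω ξ = wdist α ξ ω := by
  rw [wdist, wdist, abs_sub_comm]

lemma wdist_le_add (α ω ξ η : ℝ) : wdist α ω η ≤ wdist α ω ξ + wdist α η ξ := by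
  rw [wdist_comm α η ξ]
  unfold wdist
  linarith [abs_sub_le (warp α ω) (warp α ξ) (warp α η)]

lemma continuous_wdist (α ω : ℝ) : Continuous (wdist α ω) :=
  continuous_const.add (continuous_const.sub (continuous_warp α)).abs

lemma one_add_abs_le (hα0 : 0 ≤ α) (hα1 : α < 1) (ω ξ : ℝ) :
    1 + |ω| ≤ (1 + |ξ|) * wdist α ω ξ ^ (1 / (1 - α)) := by
  have hα : 0 < 1 - α := by linarith
  have e (ω : ℝ) : (1 + |ω|) ^ (1 - α) = 1 + (1 - α) * |warp α ω| := by
    rw [abs_warp hα1]; field_simp; ring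
  have h : (1 + |ω|) ^ (1 - α) ≤ (1 + |ξ|) ^ (1 - α) * wdist α ω ξ := by
    have h1 := abs_sub_abs_le_abs_sub (warp α ω) (warp α ξ)
    have h2 := abs_nonneg (warp α ω - warp α ξ)
    rw [e, e, wdist]
    nlinarith [mul_nonneg (mul_nonneg hα.le (abs_nonneg (warp α ξ))) h2]
  refine (Real.rpow_le_rpow_iff (by positivity) (mul_nonneg (by positivity)
    (wdist_rpow_nonneg ..)) hα).1 (h.trans_eq ?_)
  rw [Real.mul_rpow (by positivity) (wdist_rpow_nonneg ..), ← Real.rpow_mul (wdist_pos ..).le,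
    one_div_mul_cancel hα.ne', Real.rpow_one]

lemma one_add_abs_rpow_le (hα0 : 0 ≤ α) (hα1 : α < 1) (s ω ξ : ℝ) :
    (1 + |ω|) ^ s ≤ (1 + |ξ|) ^ s * wdist α ω ξ ^ (|s| / (1 - α)) := by
  have key {s : ℝ} (hs : 0 ≤ s) (ω ξ : ℝ) :
      (1 + |ω|) ^ s ≤ (1 + |ξ|) ^ s * wdist α ω ξ ^ (s / (1 - α)) := by
    have h := Real.rpow_le_rpow (by positivity) (one_add_abs_le hα0 hα1 ω ξ) hs
    rwa [Real.mul_rpow (by positivity) (wdist_rpow_nonneg ..), ← Real.rpow_mul (wdist_pos ..).le,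
      one_div_mul_eq_div] at h
  rcases le_total 0 s with hs | hs
  · rw [abs_of_nonneg hs]; exact key hs ω ξ
  · have h := key (neg_nonneg.2 hs) ξ ω
    rw [Real.rpow_neg (by positivity), Real.rpow_neg (by positivity), inv_mul_eq_div,
      le_div_iff₀ (by positivity), inv_mul_le_iff₀ (by positivity), wdist_comm] at h
    rwa [abs_of_nonpos hs]

lemma beta_le (hα0 : 0 ≤ α) (hα1 : α < 1) (ω ξ : ℝ) :
    beta α ω ≤ beta α ξ * wdist α ω ξ ^ (α / (1 - α)) := by
  simpa only [beta, abs_neg, abs_of_nonneg hα0] using one_add_abs_rpow_le hα0 hα1 (-α) ω ξ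

lemma polyWeight_pos (s : ℝ) (z : X) : 0 < polyWeight s z :=
  Real.rpow_pos_of_pos (by positivity) _

lemma continuous_polyWeight (s : ℝ) : Continuous (polyWeight s) :=
  (by fun_prop : Continuous fun z : X => 1 + |z.2|).rpow_const fun z => Or.inl (by positivity)

lemma ratioWeight_comm (v : X → ℝ) (z z' : X) : ratioWeight v z z' = ratioWeight v z' z :=
  max_comm _ _

lemma continuous_ratioWeight_polyWeight (s : ℝ) :
    Continuous fun p : X × X => ratioWeight (polyWeight s) p.1 p.2 := by
  have h1 := (continuous_polyWeight s).comp (continuous_fst (X := X) (Y := X))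
  have h2 := (continuous_polyWeight s).comp (continuous_snd (X := X) (Y := X))
  exact (h1.div h2 fun p => (polyWeight_pos ..).ne').max
    (h2.div h1 fun p => (polyWeight_pos ..).ne')

lemma ratioWeight_polyWeight_le (hα0 : 0 ≤ α) (hα1 : α < 1) (s : ℝ) (z z' : X) :
    ratioWeight (polyWeight s) z z' ≤ wdist α z.2 z'.2 ^ (|s| / (1 - α)) := by
  refine max_le ?_ ?_
  · rw [div_le_iff₀' (polyWeight_pos s z')]
    exact one_add_abs_rpow_le hα0 hα1 s _ _
  · rw [div_le_iff₀' (polyWeight_pos s z), wdist_comm]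
    exact one_add_abs_rpow_le hα0 hα1 s _ _

/-- The constant `∫ (1 + |u|)^{-N} du`, meant for `N > 1`. -/
noncomputable def decayInt (N : ℝ) : ℝ := ∫ u : ℝ, (1 + |u|) ^ (-N)

lemma decayInt_nonneg (N : ℝ) : 0 ≤ decayInt N := integral_nonneg fun u => by positivity

lemma lintegral_one_add_abs_rpow {N : ℝ} (hN : 1 < N) :
    ∫⁻ u : ℝ, ENNReal.ofReal ((1 + |u|) ^ (-N)) = ENNReal.ofReal (decayInt N) :=
  (ofReal_integral_eq_lintegral_ofReal (integrable_one_add_norm (by simpa using hN))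
    (.of_forall fun u => by positivity)).symm

lemma lintegral_beta_mul_wdist_le {N : ℝ} (hN : 1 < N) (α ξ : ℝ) :
    ∫⁻ ω, ENNReal.ofReal (beta α ω * wdist α ω ξ ^ (-N)) ≤ ENNReal.ofReal (decayInt N) := by
  have h := lintegral_image_eq_lintegral_abs_deriv_mul MeasurableSet.univ
    (fun ω _ => (hasDerivAt_warp α ω).hasDerivWithinAt) (warp_strictMono α).injective.injOn
    (fun u => ENNReal.ofReal ((1 + |u - warp α ξ|) ^ (-N)))
  calc _ = ∫⁻ ω, ENNReal.ofReal |beta α ω| *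
        ENNReal.ofReal ((1 + |warp α ω - warp α ξ|) ^ (-N)) := by
        refine lintegral_congr fun ω => ?_
        rw [abs_of_pos (beta_pos α ω), ENNReal.ofReal_mul (beta_pos α ω).le, wdist]
    _ = ∫⁻ u in warp α '' Set.univ, ENNReal.ofReal ((1 + |u - warp α ξ|) ^ (-N)) := by
        rw [h, setLIntegral_univ]
    _ ≤ ∫⁻ u, ENNReal.ofReal ((1 + |u - warp α ξ|) ^ (-N)) := setLIntegral_le_lintegral _ _
    _ = ENNReal.ofReal (decayInt N) := by
        rw [← lintegral_one_add_abs_rpow hN,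
          lintegral_sub_right_eq_self fun u : ℝ => ENNReal.ofReal ((1 + |u|) ^ (-N))]

lemma lintegral_wdist_le (hα0 : 0 ≤ α) (hα1 : α < 1) {N : ℝ} (hN : 1 + α / (1 - α) < N)
    (ω : ℝ) : ∫⁻ ξ, ENNReal.ofReal (wdist α ω ξ ^ (-N)) ≤
      ENNReal.ofReal ((beta α ω)⁻¹ * decayInt (N - α / (1 - α))) := by
  have hβ := beta_pos α ω
  rw [ENNReal.ofReal_mul (by positivity)]
  refine le_trans ?_ (mul_le_mul_right (lintegral_beta_mul_wdist_le (by linarith) α ω) _)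
  rw [← lintegral_const_mul' _ _ ENNReal.ofReal_ne_top]
  refine lintegral_mono fun ξ => ?_
  rw [← ENNReal.ofReal_mul (by positivity), wdist_comm α ξ ω,
    show -(N - α / (1 - α)) = α / (1 - α) + -N by ring, Real.rpow_add (wdist_pos ..)]
  refine ENNReal.ofReal_le_ofReal ((le_inv_mul_iff₀ hβ).2 ?_)
  rw [← mul_assoc]
  exact mul_le_mul_of_nonneg_right (beta_le hα0 hα1 ω ξ) (wdist_rpow_nonneg ..)

lemma mul_rpow_neg_le {A B D N : ℝ} (hA : 0 < A) (hB : 0 < B) (hD : 0 < D) (h : D ≤ A + B)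
    (hN : 0 ≤ N) : A ^ (-N) * B ^ (-N) ≤ (D / 2) ^ (-N) * (A ^ (-N) + B ^ (-N)) := by
  have pA := Real.rpow_pos_of_pos hA (-N)
  have pB := Real.rpow_pos_of_pos hB (-N)
  have pD := Real.rpow_pos_of_pos (by linarith : 0 < D / 2) (-N)
  rcases le_total A B with hAB | hAB
  · have : B ^ (-N) ≤ (D / 2) ^ (-N) :=
      Real.rpow_le_rpow_of_nonpos (by linarith) (by linarith) (by linarith)
    nlinarith [mul_pos pD pB]
  · have : A ^ (-N) ≤ (D / 2) ^ (-N) :=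
      Real.rpow_le_rpow_of_nonpos (by linarith) (by linarith) (by linarith)
    nlinarith [mul_pos pD pA]

lemma lintegral_wdist_mul_wdist_le (hα0 : 0 ≤ α) (hα1 : α < 1) {N : ℝ}
    (hN : 1 + α / (1 - α) < N) (ω ω' : ℝ) :
    ∫⁻ ξ, ENNReal.ofReal (wdist α ω ξ ^ (-N) * wdist α ω' ξ ^ (-N)) ≤
      ENNReal.ofReal ((wdist α ω ω' / 2) ^ (-N) *
        (((beta α ω)⁻¹ + (beta α ω')⁻¹) * decayInt (N - α / (1 - α)))) := by
  have hN0 : 0 ≤ N := by linarith [div_nonneg hα0 (by linarith : 0 ≤ 1 - α)]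
  have hD : 0 ≤ (wdist α ω ω' / 2) ^ (-N) := Real.rpow_nonneg (by linarith [wdist_pos α ω ω']) _
  have hβ := beta_pos α ω
  have hβ' := beta_pos α ω'
  have hI := decayInt_nonneg (N - α / (1 - α))
  calc _ ≤ ∫⁻ ξ, ENNReal.ofReal ((wdist α ω ω' / 2) ^ (-N)) *
        (ENNReal.ofReal (wdist α ω ξ ^ (-N)) + ENNReal.ofReal (wdist α ω' ξ ^ (-N))) := by
        refine lintegral_mono fun ξ => ?_
        rw [← ENNReal.ofReal_add (wdist_rpow_nonneg ..) (wdist_rpow_nonneg ..),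
          ← ENNReal.ofReal_mul hD]
        exact ENNReal.ofReal_le_ofReal (mul_rpow_neg_le (wdist_pos ..) (wdist_pos ..)
          (wdist_pos ..) (wdist_le_add ..) hN0)
    _ ≤ ENNReal.ofReal ((wdist α ω ω' / 2) ^ (-N)) *
        (ENNReal.ofReal ((beta α ω)⁻¹ * decayInt (N - α / (1 - α))) +
          ENNReal.ofReal ((beta α ω')⁻¹ * decayInt (N - α / (1 - α)))) := by
        rw [lintegral_const_mul' _ _ ENNReal.ofReal_ne_top,
          lintegral_add_left ((continuous_wdist α ω).measurable.pow_const _).ennreal_ofReal]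
        gcongr <;> exact lintegral_wdist_le hα0 hα1 hN _
    _ = _ := by
        rw [← ENNReal.ofReal_add (by positivity) (by positivity), ← ENNReal.ofReal_mul hD,
          ← add_mul]

end Warp

section Molecule

variable {α t C C' : ℝ} {e e' : X → L2} {P P' : ℝ → ℝ → ℂ}

/-- The family `e` consists of molecules of order `t`: the Fourier transform of `e (x, ω)` is
`e^{-2πixξ} P(ω, ξ)` with a profile `P` concentrated, together with its `ξ`-derivative, near `ω` at
the scale `1 / β(ω)`; the concentration is measured in the warped distance. -/
structure IsMolecule (α t C : ℝ) (e : X → L2) (P : ℝ → ℝ → ℂ) : Prop where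
  continuous : Continuous fun p : ℝ × ℝ => P p.1 p.2
  differentiable : ∀ ω, Differentiable ℝ (P ω)
  norm_le : ∀ ω ξ, ‖P ω ξ‖ ≤ C * √(beta α ω) * wdist α ω ξ ^ (-t)
  norm_deriv_le : ∀ ω ξ,
    ‖deriv (P ω) ξ‖ ≤ C * √(beta α ω) * beta α ω * wdist α ω ξ ^ (-t)
  fourier_ae : ∀ z : X, ⇑(𝓕 (e z) : L2) =ᵐ[volume]
    fun ξ => Complex.exp (-(2 * Real.pi * Complex.I * z.1 * ξ)) * P z.2 ξ

lemma IsMolecule.nonneg (he : IsMolecule α t C e P) : 0 ≤ C := by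
  have h := (norm_nonneg _).trans (he.norm_le 0 0)
  rw [mul_assoc] at h
  exact nonneg_of_mul_nonneg_left h
    (mul_pos (Real.sqrt_pos.2 (beta_pos α 0)) (Real.rpow_pos_of_pos (wdist_pos α 0 0) _))

lemma ip_eq_integral (f g : L2) : ip f g = ∫ t, f t * starRingEnd ℂ (g t) := by
  rw [ip, MeasureTheory.L2.inner_def]
  rfl

lemma conj_exp_phase (x ξ : ℝ) :
    starRingEnd ℂ (Complex.exp (-(2 * Real.pi * Complex.I * x * ξ))) =
      Complex.exp (2 * Real.pi * Complex.I * x * ξ) := by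
  rw [← Complex.exp_conj]
  congr 1
  simp only [map_neg, map_mul, Complex.conj_ofReal, Complex.conj_I, Complex.conj_ofNat]
  ring

lemma IsMolecule.ip_right (he : IsMolecule α t C e P) (f : L2) (z : X) :
    ip f (e z) = ∫ ξ : ℝ, Complex.exp (2 * Real.pi * Complex.I * z.1 * ξ) *
      ((𝓕 f : L2) ξ * starRingEnd ℂ (P z.2 ξ)) := by
  rw [← ip_fourier, ip_eq_integral]
  refine integral_congr_ae ?_
  filter_upwards [he.fourier_ae z] with ξ hξ
  rw [hξ, map_mul, conj_exp_phase]
  ring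

lemma IsMolecule.stronglyMeasurable_ip (he : IsMolecule α t C e P) (f : L2) :
    StronglyMeasurable fun z => ip f (e z) := by
  have hP : Continuous fun p : X × ℝ => starRingEnd ℂ (P p.1.2 p.2) :=
    Complex.continuous_conj.comp (he.continuous.comp (by fun_prop : Continuous fun p : X × ℝ =>
      (p.1.2, p.2)))
  have hexp : Continuous fun p : X × ℝ =>
      Complex.exp (2 * Real.pi * Complex.I * p.1.1 * p.2) := by fun_prop
  simp only [he.ip_right f]
  exact (hexp.stronglyMeasurable.mul (((Lp.stronglyMeasurable (𝓕 f : L2)).comp_measurable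
    measurable_snd).mul hP.stronglyMeasurable)).integral_prod_right'

lemma IsMolecule.ip_eq_fourier (he : IsMolecule α t C e P) (he' : IsMolecule α t C' e' P')
    (z z' : X) :
    ip (e z) (e' z') = 𝓕 (fun ξ => P z.2 ξ * starRingEnd ℂ (P' z'.2 ξ)) (z.1 - z'.1) := by
  rw [he'.ip_right, Real.fourier_real_eq_integral_exp_smul]
  refine integral_congr_ae ?_
  filter_upwards [he.fourier_ae z] with ξ hξ
  have hexp : Complex.exp (↑(-2 * Real.pi * ξ * (z.1 - z'.1)) * Complex.I) =
      Complex.exp (2 * Real.pi * Complex.I * z'.1 * ξ) *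
        Complex.exp (-(2 * Real.pi * Complex.I * z.1 * ξ)) := by
    rw [← Complex.exp_add]
    congr 1
    push_cast
    ring
  rw [hξ, smul_eq_mul, hexp]
  ring

lemma IsMolecule.stronglyMeasurable_kernel (he : IsMolecule α t C e P)
    (he' : IsMolecule α t C' e' P') : StronglyMeasurable fun p : X × X => ip (e p.1) (e' p.2) := by
  have hP : Continuous fun p : (X × X) × ℝ => P p.1.1.2 p.2 :=
    he.continuous.comp (by fun_prop : Continuous fun p : (X × X) × ℝ => (p.1.1.2, p.2))
  have hP' : Continuous fun p : (X × X) × ℝ => starRingEnd ℂ (P' p.1.2.2 p.2) :=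
    Complex.continuous_conj.comp (he'.continuous.comp
      (by fun_prop : Continuous fun p : (X × X) × ℝ => (p.1.2.2, p.2)))
  have hexp : Continuous fun p : (X × X) × ℝ =>
      Complex.exp (↑(-2 * Real.pi * p.2 * (p.1.1.1 - p.1.2.1)) * Complex.I) := by fun_prop
  simp only [he.ip_eq_fourier he', Real.fourier_real_eq_integral_exp_smul]
  exact (hexp.smul (hP.mul hP')).stronglyMeasurable.integral_prod_right'

lemma rpow_neg_sq {D : ℝ} (hD : 0 ≤ D) (t : ℝ) : (D ^ (-t)) ^ 2 = D ^ (-(2 * t)) := by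
  rw [← Real.rpow_mul_natCast hD, Nat.cast_ofNat, neg_mul, mul_comm]

lemma memLp_two_of_norm_le_wdist (hα0 : 0 ≤ α) (hα1 : α < 1) (ht : 1 + α / (1 - α) < 2 * t)
    {f : ℝ → ℂ} (hf : AEStronglyMeasurable f) {K : ℝ} (ω : ℝ)
    (hle : ∀ ξ, ‖f ξ‖ ≤ K * wdist α ω ξ ^ (-t)) : MemLp f 2 := by
  have hint := lintegral_wdist_le hα0 hα1 ht ω
  have hw : MemLp (fun ξ => wdist α ω ξ ^ (-t)) 2 := by
    have hcont : Continuous fun ξ => wdist α ω ξ ^ (-t) :=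
      (continuous_wdist α ω).rpow_const fun ξ => Or.inl (wdist_pos ..).ne'
    refine ⟨hcont.aestronglyMeasurable, (eLpNorm_two_le_ofReal_sqrt ?_
      (le_trans (lintegral_mono fun ξ => ?_) hint)).trans_lt ENNReal.ofReal_lt_top⟩
    · exact mul_nonneg (inv_nonneg.2 (beta_pos α ω).le) (decayInt_nonneg _)
    · rw [Real.enorm_of_nonneg (wdist_rpow_nonneg ..), ← ENNReal.ofReal_pow (wdist_rpow_nonneg ..),
        rpow_neg_sq (wdist_pos ..).le]
  exact hw.of_le_mul hf (.of_forall fun ξ => by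
    simpa only [Real.norm_of_nonneg (wdist_rpow_nonneg ..)] using hle ξ)

lemma eLpNorm_wdist_mul_wdist_le (hα0 : 0 ≤ α) (hα1 : α < 1) (ht : 1 + α / (1 - α) < 2 * t)
    (ω ω' : ℝ) : eLpNorm (fun ξ => wdist α ω ξ ^ (-t) * wdist α ω' ξ ^ (-t)) 2 ≤
      ENNReal.ofReal ((wdist α ω ω' / 2) ^ (-t) *
        √(((beta α ω)⁻¹ + (beta α ω')⁻¹) * decayInt (2 * t - α / (1 - α)))) := by
  have hD : 0 ≤ wdist α ω ω' / 2 := (half_pos (wdist_pos ..)).le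
  have hD' : (wdist α ω ω' / 2) ^ (-(2 * t)) = ((wdist α ω ω' / 2) ^ (-t)) ^ 2 :=
    (rpow_neg_sq hD t).symm
  have hI := decayInt_nonneg (2 * t - α / (1 - α))
  have hβ := beta_pos α ω
  have hβ' := beta_pos α ω'
  have h := lintegral_wdist_mul_wdist_le hα0 hα1 ht ω ω'
  rw [hD'] at h
  refine (eLpNorm_two_le_ofReal_sqrt (by positivity) (le_trans (lintegral_mono fun ξ => ?_)
    h)).trans_eq ?_
  · have hw := mul_nonneg (wdist_rpow_nonneg α ω ξ (-t)) (wdist_rpow_nonneg α ω' ξ (-t))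
    rw [Real.enorm_of_nonneg hw, ← ENNReal.ofReal_pow hw, mul_pow, rpow_neg_sq (wdist_pos ..).le,
      rpow_neg_sq (wdist_pos ..).le]
  · rw [Real.sqrt_mul (by positivity), Real.sqrt_sq (Real.rpow_nonneg hD _)]

end Molecule

section Kernel

variable {α t C C' : ℝ} {e e' : X → L2} {P P' : ℝ → ℝ → ℂ}

lemma hasDerivAt_mul_conj {p q : ℝ → ℂ} (hp : Differentiable ℝ p) (hq : Differentiable ℝ q)
    (ξ : ℝ) : HasDerivAt (fun ξ => p ξ * starRingEnd ℂ (q ξ))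
      (deriv p ξ * starRingEnd ℂ (q ξ) + p ξ * starRingEnd ℂ (deriv q ξ)) ξ :=
  (hp ξ).hasDerivAt.mul (hq ξ).hasDerivAt.star

lemma IsMolecule.norm_mul_conj_le (he : IsMolecule α t C e P) (he' : IsMolecule α t C' e' P')
    (ω ω' ξ : ℝ) : ‖P ω ξ * starRingEnd ℂ (P' ω' ξ)‖ ≤ C * C' * (√(beta α ω) * √(beta α ω')) *
      (wdist α ω ξ ^ (-t) * wdist α ω' ξ ^ (-t)) := by
  rw [norm_mul, RCLike.norm_conj]
  calc _ ≤ C * √(beta α ω) * wdist α ω ξ ^ (-t) * (C' * √(beta α ω') * wdist α ω' ξ ^ (-t)) :=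
        mul_le_mul (he.norm_le ω ξ) (he'.norm_le ω' ξ) (norm_nonneg _)
          ((norm_nonneg _).trans (he.norm_le ω ξ))
    _ = _ := by ring

lemma IsMolecule.norm_deriv_mul_conj_le (he : IsMolecule α t C e P)
    (he' : IsMolecule α t C' e' P') (ω ω' ξ : ℝ) :
    ‖deriv (fun ξ => P ω ξ * starRingEnd ℂ (P' ω' ξ)) ξ‖ ≤
      C * C' * (√(beta α ω) * √(beta α ω')) * (beta α ω + beta α ω') *
        (wdist α ω ξ ^ (-t) * wdist α ω' ξ ^ (-t)) := by
  rw [(hasDerivAt_mul_conj (he.differentiable ω) (he'.differentiable ω') ξ).deriv]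
  refine (norm_add_le _ _).trans ?_
  rw [norm_mul, norm_mul, RCLike.norm_conj, RCLike.norm_conj]
  calc _ ≤ C * √(beta α ω) * beta α ω * wdist α ω ξ ^ (-t) *
          (C' * √(beta α ω') * wdist α ω' ξ ^ (-t)) +
        C * √(beta α ω) * wdist α ω ξ ^ (-t) *
          (C' * √(beta α ω') * beta α ω' * wdist α ω' ξ ^ (-t)) :=
        add_le_add
          (mul_le_mul (he.norm_deriv_le ω ξ) (he'.norm_le ω' ξ) (norm_nonneg _)
            ((norm_nonneg _).trans (he.norm_deriv_le ω ξ)))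
          (mul_le_mul (he.norm_le ω ξ) (he'.norm_deriv_le ω' ξ) (norm_nonneg _)
            ((norm_nonneg _).trans (he.norm_le ω ξ)))
    _ = _ := by ring

lemma eLpNorm_two_le_of_norm_le_wdist_mul_wdist (hα0 : 0 ≤ α) (hα1 : α < 1)
    (ht : 1 + α / (1 - α) < 2 * t) {f : ℝ → ℂ} {K : ℝ} (hK : 0 ≤ K) {ω ω' : ℝ}
    (hle : ∀ ξ, ‖f ξ‖ ≤ K * (wdist α ω ξ ^ (-t) * wdist α ω' ξ ^ (-t))) :
    eLpNorm f 2 ≤ ENNReal.ofReal (K * ((wdist α ω ω' / 2) ^ (-t) *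
      √(((beta α ω)⁻¹ + (beta α ω')⁻¹) * decayInt (2 * t - α / (1 - α))))) := by
  rw [ENNReal.ofReal_mul hK]
  refine (eLpNorm_le_mul_eLpNorm_of_ae_le_mul (.of_forall fun ξ => ?_) 2).trans
    (mul_le_mul_right (eLpNorm_wdist_mul_wdist_le hα0 hα1 ht ω ω') _)
  rw [Real.norm_of_nonneg (mul_nonneg (wdist_rpow_nonneg ..) (wdist_rpow_nonneg ..))]
  exact hle ξ

lemma IsMolecule.memLp_two (he : IsMolecule α t C e P) (ω : ℝ) : MemLp (P ω) 2 := by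
  refine (Lp.memLp (𝓕 (e (0, ω)) : L2)).ae_eq ((he.fourier_ae (0, ω)).trans ?_)
  exact .of_forall fun ξ => by simp

lemma IsMolecule.memLp_two_deriv (hα0 : 0 ≤ α) (hα1 : α < 1) (ht : 1 + α / (1 - α) < 2 * t)
    (he : IsMolecule α t C e P) (ω : ℝ) : MemLp (deriv (P ω)) 2 :=
  memLp_two_of_norm_le_wdist hα0 hα1 ht (measurable_deriv _).aestronglyMeasurable ω
    (he.norm_deriv_le ω)

lemma IsMolecule.integrable_mul_conj (he : IsMolecule α t C e P) (he' : IsMolecule α t C' e' P')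
    (ω ω' : ℝ) : Integrable fun ξ => P ω ξ * starRingEnd ℂ (P' ω' ξ) :=
  (he.memLp_two ω).integrable_mul (he'.memLp_two ω').star

lemma IsMolecule.integrable_deriv_mul_conj (hα0 : 0 ≤ α) (hα1 : α < 1)
    (ht : 1 + α / (1 - α) < 2 * t) (he : IsMolecule α t C e P) (he' : IsMolecule α t C' e' P')
    (ω ω' : ℝ) : Integrable (deriv fun ξ => P ω ξ * starRingEnd ℂ (P' ω' ξ)) := by
  rw [funext fun ξ =>
    (hasDerivAt_mul_conj (he.differentiable ω) (he'.differentiable ω') ξ).deriv]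
  exact ((he.memLp_two_deriv hα0 hα1 ht ω).integrable_mul (he'.memLp_two ω').star).add
    ((he.memLp_two ω).integrable_mul (he'.memLp_two_deriv hα0 hα1 ht ω').star)

/-- The constant in the off-diagonal decay of cross kernels of molecules of order `t`. -/
noncomputable def kernelConst (α t : ℝ) : ℝ :=
  2 * (1 / 2) ^ (-t) * √(Real.pi * decayInt (2 * t - α / (1 - α)))

lemma kernelConst_nonneg (α t : ℝ) : 0 ≤ kernelConst α t := by
  unfold kernelConst
  positivity

lemma sqrt_pi_mul_add_eq {b b' D t I : ℝ} (hb : 0 < b) (hb' : 0 < b') (hD : 0 ≤ D)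
    (K : ℝ) : √(Real.pi * (b + b')) *
      (K * (√b * √b') * ((D / 2) ^ (-t) * √((b⁻¹ + b'⁻¹) * I)) +
        (b + b')⁻¹ * (K * (√b * √b') * (b + b') * ((D / 2) ^ (-t) * √((b⁻¹ + b'⁻¹) * I)))) =
      2 * (1 / 2) ^ (-t) * √(Real.pi * I) * K * ((b + b') * D ^ (-t)) := by
  have hsum : b⁻¹ + b'⁻¹ = (b + b') / (b * b') := by field_simp; ring
  have hsq : √(b + b') * √(b + b') = b + b' := Real.mul_self_sqrt (by positivity)
  rw [div_eq_mul_one_div D, Real.mul_rpow hD (by norm_num), Real.sqrt_mul (by positivity),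
    Real.sqrt_mul (by positivity), Real.sqrt_mul (by positivity), hsum,
    Real.sqrt_div (by positivity), Real.sqrt_mul hb.le]
  calc _ = 2 * (1 / 2) ^ (-t) * (√Real.pi * √I) * K * (√(b + b') * √(b + b') * D ^ (-t)) := by
        field_simp
        ring
    _ = _ := by rw [hsq]

theorem IsMolecule.eLpNorm_fourier_mul_conj_le (hα0 : 0 ≤ α) (hα1 : α < 1)
    (ht : 1 + α / (1 - α) < 2 * t) (he : IsMolecule α t C e P) (he' : IsMolecule α t C' e' P')
    (ω ω' : ℝ) :
    eLpNorm (𝓕 fun ξ => P ω ξ * starRingEnd ℂ (P' ω' ξ)) 1 ≤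
      ENNReal.ofReal (kernelConst α t * (C * C') *
        ((beta α ω + beta α ω') * wdist α ω ω' ^ (-t))) := by
  have hβ := beta_pos α ω
  have hβ' := beta_pos α ω'
  have hK : 0 ≤ C * C' * (√(beta α ω) * √(beta α ω')) :=
    mul_nonneg (mul_nonneg he.nonneg he'.nonneg) (by positivity)
  have hd : Differentiable ℝ fun ξ => P ω ξ * starRingEnd ℂ (P' ω' ξ) := fun ξ =>
    (hasDerivAt_mul_conj (he.differentiable ω) (he'.differentiable ω') ξ).differentiableAt
  have h2 := eLpNorm_two_le_of_norm_le_wdist_mul_wdist hα0 hα1 ht hK (he.norm_mul_conj_le he' ω ω')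
  have h2' := eLpNorm_two_le_of_norm_le_wdist_mul_wdist hα0 hα1 ht
    (mul_nonneg hK (add_pos hβ hβ').le) (he.norm_deriv_mul_conj_le he' ω ω')
  refine (eLpNorm_one_fourier_le hd (he.integrable_mul_conj he' ω ω')
    (he.integrable_deriv_mul_conj hα0 hα1 ht he' ω ω')
    ⟨hd.continuous.aestronglyMeasurable, h2.trans_lt ENNReal.ofReal_lt_top⟩
    ⟨(measurable_deriv _).aestronglyMeasurable, h2'.trans_lt ENNReal.ofReal_lt_top⟩
    (add_pos hβ hβ')).trans ?_
  have hD := Real.rpow_nonneg (half_pos (wdist_pos α ω ω')).le (-t)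
  rw [kernelConst, ← sqrt_pi_mul_add_eq hβ hβ' (wdist_pos α ω ω').le,
    ENNReal.ofReal_mul (Real.sqrt_nonneg _), ENNReal.ofReal_add (by positivity) (by positivity),
    ENNReal.ofReal_mul (inv_nonneg.2 (add_pos hβ hβ').le)]
  gcongr

lemma wdist_decay_mul_le (hα0 : 0 ≤ α) (hα1 : α < 1) (s t ω ω' : ℝ) :
    (beta α ω + beta α ω') * wdist α ω ω' ^ (-t) * wdist α ω ω' ^ (|s| / (1 - α)) ≤
      2 * (beta α ω * wdist α ω ω' ^ (-(t - (|s| + α) / (1 - α)))) := by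
  have hD := wdist_pos α ω ω'
  have hβ := beta_pos α ω
  have hβ' : beta α ω' ≤ beta α ω * wdist α ω ω' ^ (α / (1 - α)) := by
    rw [wdist_comm]
    exact beta_le hα0 hα1 ω' ω
  have hone : 1 ≤ wdist α ω ω' ^ (α / (1 - α)) :=
    Real.one_le_rpow (one_le_wdist ..) (div_nonneg hα0 (by linarith))
  have hsum : beta α ω + beta α ω' ≤ 2 * (beta α ω * wdist α ω ω' ^ (α / (1 - α))) := by nlinarith
  rw [show -(t - (|s| + α) / (1 - α)) = α / (1 - α) + (-t + |s| / (1 - α)) by ring,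
    Real.rpow_add hD, Real.rpow_add hD]
  calc _ ≤ 2 * (beta α ω * wdist α ω ω' ^ (α / (1 - α))) * wdist α ω ω' ^ (-t) *
        wdist α ω ω' ^ (|s| / (1 - α)) := by gcongr
    _ = _ := by ring

lemma IsMolecule.lintegral_kernel_slice_le (hα0 : 0 ≤ α) (hα1 : α < 1) (s : ℝ)
    (ht : 1 + α / (1 - α) < 2 * t) (he : IsMolecule α t C e P) (he' : IsMolecule α t C' e' P')
    (ω : ℝ) (z' : X) :
    ∫⁻ x, ‖ip (e (x, ω)) (e' z')‖ₑ * ENNReal.ofReal (ratioWeight (polyWeight s) (x, ω) z') ≤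
      ENNReal.ofReal (2 * kernelConst α t * (C * C')) *
        ENNReal.ofReal (beta α ω * wdist α ω z'.2 ^ (-(t - (|s| + α) / (1 - α)))) := by
  have hK : 0 ≤ kernelConst α t * (C * C') :=
    mul_nonneg (kernelConst_nonneg α t) (mul_nonneg he.nonneg he'.nonneg)
  calc ∫⁻ x, ‖ip (e (x, ω)) (e' z')‖ₑ * ENNReal.ofReal (ratioWeight (polyWeight s) (x, ω) z')
      ≤ ∫⁻ x, ‖𝓕 (fun ξ => P ω ξ * starRingEnd ℂ (P' z'.2 ξ)) (x - z'.1)‖ₑ *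
          ENNReal.ofReal (wdist α ω z'.2 ^ (|s| / (1 - α))) := by
        refine lintegral_mono fun x => ?_
        rw [he.ip_eq_fourier he']
        gcongr
        exact ratioWeight_polyWeight_le hα0 hα1 s _ _
    _ ≤ ENNReal.ofReal (kernelConst α t * (C * C') *
          ((beta α ω + beta α z'.2) * wdist α ω z'.2 ^ (-t))) *
          ENNReal.ofReal (wdist α ω z'.2 ^ (|s| / (1 - α))) := by
        rw [lintegral_mul_const' _ _ ENNReal.ofReal_ne_top, lintegral_sub_right_eq_self
          (fun x => ‖𝓕 (fun ξ => P ω ξ * starRingEnd ℂ (P' z'.2 ξ)) x‖ₑ),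
          ← eLpNorm_one_eq_lintegral_enorm]
        gcongr
        exact he.eLpNorm_fourier_mul_conj_le hα0 hα1 ht he' ω z'.2
    _ ≤ _ := by
        rw [← ENNReal.ofReal_mul' (wdist_rpow_nonneg ..), ← ENNReal.ofReal_mul (by linarith)]
        refine ENNReal.ofReal_le_ofReal ?_
        have h := mul_le_mul_of_nonneg_left (wdist_decay_mul_le hα0 hα1 s t ω z'.2) hK
        linarith

theorem IsMolecule.lintegral_kernel_le (hα0 : 0 ≤ α) (hα1 : α < 1) {s : ℝ}
    (ht : 1 + (|s| + α) / (1 - α) < t) (he : IsMolecule α t C e P)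
    (he' : IsMolecule α t C' e' P') (z' : X) :
    ∫⁻ z : X, ‖ip (e z) (e' z')‖ₑ * ENNReal.ofReal (ratioWeight (polyWeight s) z z') ≤
      ENNReal.ofReal (2 * kernelConst α t * (C * C')) *
        ENNReal.ofReal (decayInt (t - (|s| + α) / (1 - α))) := by
  have ha : 0 < 1 - α := by linarith
  have ht' : 1 + α / (1 - α) < 2 * t := by
    have := div_nonneg (abs_nonneg s) ha.le
    have := div_nonneg hα0 ha.le
    rw [add_div] at ht
    linarith
  have hmeas : Measurable fun z : X => ‖ip (e z) (e' z')‖ₑ *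
      ENNReal.ofReal (ratioWeight (polyWeight s) z z') :=
    (((he.stronglyMeasurable_kernel he').measurable.comp measurable_prodMk_right).enorm).mul
      ((continuous_ratioWeight_polyWeight s).measurable.comp
        measurable_prodMk_right).ennreal_ofReal
  rw [Measure.volume_eq_prod, lintegral_prod_symm' _ hmeas]
  refine (lintegral_mono fun ω =>
    he.lintegral_kernel_slice_le hα0 hα1 s ht' he' ω z').trans ?_
  rw [lintegral_const_mul' _ _ ENNReal.ofReal_ne_top]
  gcongr
  exact lintegral_beta_mul_wdist_le (by linarith) α z'.2

end Kernel

section Multiplier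

lemma memLp_bounded_mul (b : ℝ →ᵇ ℂ) (f : L2) : MemLp (fun ξ => b ξ * f ξ) 2 :=
  (Lp.memLp f).of_le_mul (b.continuous.aestronglyMeasurable.mul (Lp.aestronglyMeasurable f))
    (.of_forall fun ξ => by
      rw [norm_mul]
      exact mul_le_mul_of_nonneg_right (b.norm_coe_le_norm ξ) (norm_nonneg _))

/-- Multiplication by a bounded continuous function, as an operator on `L²(ℝ)`. -/
noncomputable def mulL2 (b : ℝ →ᵇ ℂ) : L2 →L[ℂ] L2 :=
  LinearMap.mkContinuous
    { toFun := fun f => (memLp_bounded_mul b f).toLp _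
      map_add' := fun f g => by
        rw [← MemLp.toLp_add]
        refine MemLp.toLp_congr _ _ ?_
        filter_upwards [Lp.coeFn_add f g] with ξ h
        rw [h, Pi.add_apply, Pi.add_apply, mul_add]
      map_smul' := fun c f => by
        rw [RingHom.id_apply, ← MemLp.toLp_const_smul]
        refine MemLp.toLp_congr _ _ ?_
        filter_upwards [Lp.coeFn_smul c f] with ξ h
        rw [h, Pi.smul_apply, Pi.smul_apply, mul_smul_comm] }
    ‖b‖ fun f => by
      refine Lp.norm_le_mul_norm_of_ae_le_mul ?_
      filter_upwards [(memLp_bounded_mul b f).coeFn_toLp] with ξ h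
      simp only [LinearMap.coe_mk, AddHom.coe_mk]
      rw [h, norm_mul]
      exact mul_le_mul_of_nonneg_right (b.norm_coe_le_norm ξ) (norm_nonneg _)

lemma mulL2_ae (b : ℝ →ᵇ ℂ) (f : L2) : ⇑(mulL2 b f) =ᵐ[volume] fun ξ => b ξ * f ξ :=
  (memLp_bounded_mul b f).coeFn_toLp

/-- The Fourier multiplier with symbol `b`. -/
noncomputable def fmul (b : ℝ →ᵇ ℂ) : L2 →L[ℂ] L2 :=
  ((Lp.fourierTransformₗᵢ ℝ ℂ).symm.toContinuousLinearEquiv : L2 →L[ℂ] L2) ∘L mulL2 b ∘L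
    ((Lp.fourierTransformₗᵢ ℝ ℂ).toContinuousLinearEquiv : L2 →L[ℂ] L2)

lemma fourier_fmul_ae (b : ℝ →ᵇ ℂ) (f : L2) :
    ⇑(𝓕 (fmul b f) : L2) =ᵐ[volume] fun ξ => b ξ * (𝓕 f : L2) ξ := by
  rw [show fmul b f = 𝓕⁻ (mulL2 b (𝓕 f)) from rfl, FourierTransform.fourier_fourierInv_eq]
  exact mulL2_ae b _

lemma fourier_injective : Function.Injective (𝓕 : L2 → L2) :=
  (Lp.fourierTransformₗᵢ ℝ ℂ).injective

lemma fmul_mul (b c : ℝ →ᵇ ℂ) : fmul b * fmul c = fmul (b * c) := by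
  ext1 f
  refine fourier_injective (Lp.ext ?_)
  rw [mul_apply_eq_comp]
  filter_upwards [fourier_fmul_ae b (fmul c f), fourier_fmul_ae c f, fourier_fmul_ae (b * c) f]
    with ξ hb hc hbc
  rw [hb, hc, hbc, BoundedContinuousFunction.mul_apply, mul_assoc]

lemma fmul_one : fmul 1 = 1 := by
  ext1 f
  refine fourier_injective (Lp.ext ?_)
  filter_upwards [fourier_fmul_ae 1 f] with ξ h
  rw [h, BoundedContinuousFunction.coe_one, Pi.one_apply, one_mul]
  rfl

lemma fmul_pow (b : ℝ →ᵇ ℂ) (k : ℕ) : fmul b ^ k = fmul (b ^ k) := by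
  induction k with
  | zero => rw [pow_zero, pow_zero, fmul_one]
  | succ k ih => rw [pow_succ, pow_succ, ih, fmul_mul]

lemma ip_fmul (b : ℝ →ᵇ ℂ) (f h : L2) :
    ip (fmul b f) h = ∫ ξ, b ξ * ((𝓕 f : L2) ξ * starRingEnd ℂ ((𝓕 h : L2) ξ)) := by
  rw [← ip_fourier, ip_eq_integral]
  refine integral_congr_ae ?_
  filter_upwards [fourier_fmul_ae b f] with ξ hξ
  rw [hξ, mul_assoc]

/-- Symbols varying slowly at the scale of the frequency covering: `|b'| ≲ β`. -/
structure IsSymbol (α : ℝ) (b : ℝ →ᵇ ℂ) : Prop where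
  differentiable : Differentiable ℝ b
  exists_norm_deriv_le : ∃ B : ℝ, ∀ ξ, ‖deriv b ξ‖ ≤ B * beta α ξ

variable {α : ℝ}

lemma isSymbol_one : IsSymbol α 1 where
  differentiable := differentiable_const (1 : ℂ)
  exists_norm_deriv_le := ⟨0, fun ξ => by
    rw [BoundedContinuousFunction.coe_one, Pi.one_def, deriv_const, norm_zero, zero_mul]⟩

lemma IsSymbol.mul {b c : ℝ →ᵇ ℂ} (hb : IsSymbol α b) (hc : IsSymbol α c) :
    IsSymbol α (b * c) := by
  obtain ⟨B, hB⟩ := hb.exists_norm_deriv_le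
  obtain ⟨B', hB'⟩ := hc.exists_norm_deriv_le
  refine ⟨hb.differentiable.mul hc.differentiable, B * ‖c‖ + ‖b‖ * B', fun ξ => ?_⟩
  rw [BoundedContinuousFunction.coe_mul, deriv_mul (hb.differentiable ξ) (hc.differentiable ξ)]
  refine (norm_add_le _ _).trans ?_
  rw [norm_mul, norm_mul]
  have h1 := mul_le_mul (hB ξ) (c.norm_coe_le_norm ξ) (norm_nonneg _)
    ((norm_nonneg _).trans (hB ξ))
  have h2 := mul_le_mul (b.norm_coe_le_norm ξ) (hB' ξ) (norm_nonneg _) (norm_nonneg _)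
  linarith

lemma IsSymbol.pow {b : ℝ →ᵇ ℂ} (hb : IsSymbol α b) (k : ℕ) : IsSymbol α (b ^ k) := by
  induction k with
  | zero => rw [pow_zero]; exact isSymbol_one
  | succ k ih => rw [pow_succ]; exact ih.mul hb

variable {t C : ℝ} {e : X → L2} {P : ℝ → ℝ → ℂ}

theorem IsMolecule.fmul (hα0 : 0 ≤ α) (hα1 : α < 1) (he : IsMolecule α t C e P) {b : ℝ →ᵇ ℂ}
    (hb : IsSymbol α b) :
    ∃ C', IsMolecule α (t - α / (1 - α)) C' (fun z => fmul b (e z)) fun ω ξ => b ξ * P ω ξ := by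
  obtain ⟨B, hB⟩ := hb.exists_norm_deriv_le
  have hB0 : 0 ≤ B := nonneg_of_mul_nonneg_left ((norm_nonneg _).trans (hB 0)) (beta_pos α 0)
  have hC := he.nonneg
  have hsplit (ω ξ : ℝ) : wdist α ω ξ ^ (-(t - α / (1 - α))) =
      wdist α ω ξ ^ (α / (1 - α)) * wdist α ω ξ ^ (-t) := by
    rw [← Real.rpow_add (wdist_pos ..), neg_sub, sub_eq_add_neg]
  have hone (ω ξ : ℝ) : 1 ≤ wdist α ω ξ ^ (α / (1 - α)) :=
    Real.one_le_rpow (one_le_wdist ..) (div_nonneg hα0 (by linarith))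
  have hle (ω ξ : ℝ) : ‖b ξ‖ ≤ ‖b‖ * wdist α ω ξ ^ (α / (1 - α)) :=
    (b.norm_coe_le_norm ξ).trans (le_mul_of_one_le_right (norm_nonneg _) (hone ω ξ))
  have hderiv (ω ξ : ℝ) : ‖deriv b ξ‖ ≤ B * (beta α ω * wdist α ω ξ ^ (α / (1 - α))) := by
    rw [wdist_comm]
    exact (hB ξ).trans (mul_le_mul_of_nonneg_left (beta_le hα0 hα1 ξ ω) hB0)
  refine ⟨(‖b‖ + B) * C, (b.continuous.comp continuous_snd).mul he.continuous,
    fun ω => hb.differentiable.mul (he.differentiable ω), fun ω ξ => ?_, fun ω ξ => ?_, fun z => ?_⟩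
  · have hW := wdist_rpow_nonneg α ω ξ (-t)
    have hW' := wdist_rpow_nonneg α ω ξ (α / (1 - α))
    rw [norm_mul, hsplit]
    calc _ ≤ ‖b‖ * wdist α ω ξ ^ (α / (1 - α)) * (C * √(beta α ω) * wdist α ω ξ ^ (-t)) :=
          mul_le_mul (hle ω ξ) (he.norm_le ω ξ) (norm_nonneg _) (by positivity)
      _ ≤ (‖b‖ + B) * wdist α ω ξ ^ (α / (1 - α)) *
          (C * √(beta α ω) * wdist α ω ξ ^ (-t)) := by
          gcongr
          linarith
      _ = _ := by ring
  · rw [deriv_fun_mul (hb.differentiable ξ) (he.differentiable ω ξ), hsplit]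
    refine (norm_add_le _ _).trans ?_
    rw [norm_mul, norm_mul]
    calc _ ≤ _ := add_le_add
          (mul_le_mul (hderiv ω ξ) (he.norm_le ω ξ) (norm_nonneg _)
            ((norm_nonneg _).trans (hderiv ω ξ)))
          (mul_le_mul (hle ω ξ) (he.norm_deriv_le ω ξ) (norm_nonneg _)
            ((norm_nonneg _).trans (hle ω ξ)))
      _ = _ := by ring
  · filter_upwards [fourier_fmul_ae b (e z), he.fourier_ae z] with ξ h1 h2
    rw [h1, h2, mul_left_comm]

end Multiplier

section Window

variable {α r C : ℝ} {ψ : L2} {g : ℝ → ℂ}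

/-- `g` is a differentiable representative of `ψ̂` such that `g` and `g'` decay with the order `r`
and the constant `C`. -/
structure IsWindow (r C : ℝ) (ψ : L2) (g : ℝ → ℂ) : Prop where
  differentiable : Differentiable ℝ g
  fourier_ae : ⇑(𝓕 ψ : L2) =ᵐ[volume] g
  norm_le : ∀ ξ, ‖g ξ‖ ≤ C * (1 + |ξ|) ^ (-r)
  norm_deriv_le : ∀ ξ, ‖deriv g ξ‖ ≤ C * (1 + |ξ|) ^ (-r)

lemma FourierDecay.exists_isWindow (h : FourierDecay r ψ) : ∃ C g, IsWindow r C ψ g := by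
  obtain ⟨g, hg, hae, C, hC⟩ := h
  refine ⟨C, g, hg.differentiable two_ne_zero, hae, fun ξ => ?_, fun ξ => ?_⟩
  · simpa only [iteratedDeriv_zero] using hC 0 zero_le_two ξ
  · simpa only [iteratedDeriv_one] using hC 1 one_le_two ξ

lemma IsWindow.nonneg (h : IsWindow r C ψ g) : 0 ≤ C :=
  nonneg_of_mul_nonneg_left ((norm_nonneg _).trans (h.norm_le 0)) (by positivity)

lemma IsWindow.integrable (hr : 1 < r) (h : IsWindow r C ψ g) : Integrable g :=
  ((integrable_one_add_norm (by simpa using hr)).const_mul C).mono'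
    h.differentiable.continuous.aestronglyMeasurable (.of_forall h.norm_le)

lemma IsWindow.memLp_two (h : IsWindow r C ψ g) : MemLp g 2 :=
  (Lp.memLp (𝓕 ψ : L2)).ae_eq h.fourier_ae

lemma IsWindow.integrable_norm_sq (h : IsWindow r C ψ g) : Integrable fun ξ => ‖g ξ‖ ^ 2 :=
  (memLp_two_iff_integrable_sq_norm h.memLp_two.aestronglyMeasurable).1 h.memLp_two

lemma IsWindow.ae_eq_fourierInv (hr : 1 < r) (h : IsWindow r C ψ g) : ⇑ψ =ᵐ[volume] 𝓕⁻ g := by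
  have hL2 := h.memLp_two
  have hψ : ψ = (𝓕⁻ (hL2.toLp g) : L2) := by
    rw [← (Lp.ext (h.fourier_ae.trans hL2.coeFn_toLp.symm) : (𝓕 ψ : L2) = hL2.toLp g),
      FourierTransform.fourierInv_fourier_eq]
  rw [hψ]
  exact fourierInv_toLp_ae (h.integrable hr) hL2

/-- The frequency profile of the vectors `π(σ(x, ω))ψ` with `ψ̂ = g`: the Fourier transform of
`M_ω D_{β(ω)} ψ`. -/
noncomputable def profile (α : ℝ) (g : ℝ → ℂ) (ω ξ : ℝ) : ℂ :=
  (√(beta α ω) : ℂ) * g (beta α ω * (ξ - ω))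

lemma norm_profile (α : ℝ) (g : ℝ → ℂ) (ω ξ : ℝ) :
    ‖profile α g ω ξ‖ = √(beta α ω) * ‖g (beta α ω * (ξ - ω))‖ := by
  rw [profile, norm_mul, Complex.norm_real, Real.norm_of_nonneg (Real.sqrt_nonneg _)]

lemma continuous_profile (hg : Continuous g) :
    Continuous fun p : ℝ × ℝ => profile α g p.1 p.2 := by
  have hβ : Continuous fun p : ℝ × ℝ => beta α p.1 := (continuous_beta α).comp continuous_fst
  exact (Complex.continuous_ofReal.comp hβ.sqrt).mul
    (hg.comp (hβ.mul (continuous_snd.sub continuous_fst)))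

lemma hasDerivAt_profile (hg : Differentiable ℝ g) (ω ξ : ℝ) :
    HasDerivAt (profile α g ω)
      (√(beta α ω) * (beta α ω * deriv g (beta α ω * (ξ - ω)))) ξ := by
  have h1 : HasDerivAt (fun ξ => beta α ω * (ξ - ω)) (beta α ω) ξ := by
    simpa using ((hasDerivAt_id' ξ).sub_const ω).const_mul (beta α ω)
  have h2 := (hg (beta α ω * (ξ - ω))).hasDerivAt.scomp ξ h1
  rw [Complex.real_smul] at h2
  exact h2.const_mul _

lemma integrable_profile (hg : Integrable g) (ω : ℝ) : Integrable (profile α g ω) :=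
  ((hg.comp_mul_left' (beta_pos α ω).ne').comp_sub_right ω).const_mul _

lemma integrable_profile_norm_sq (hg : Integrable fun ξ => ‖g ξ‖ ^ 2) (ω : ℝ) :
    Integrable fun ξ => ‖profile α g ω ξ‖ ^ 2 := by
  simp only [norm_profile, mul_pow]
  exact ((hg.comp_mul_left' (beta_pos α ω).ne').comp_sub_right ω).const_mul _

lemma norm_exp_neg_phase (x ξ : ℝ) :
    ‖Complex.exp (-(2 * Real.pi * Complex.I * x * ξ))‖ = 1 := by
  rw [show -(2 * Real.pi * Complex.I * x * ξ : ℂ) =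
    ((-(2 * Real.pi * x * ξ) : ℝ) : ℂ) * Complex.I by push_cast; ring,
    Complex.norm_exp_ofReal_mul_I]

lemma fourierInv_eq_integral (f : ℝ → ℂ) (t : ℝ) :
    𝓕⁻ f t = ∫ ξ : ℝ, Complex.exp (2 * Real.pi * Complex.I * ξ * t) * f ξ := by
  rw [Real.fourierInv_eq']
  refine integral_congr_ae (.of_forall fun ξ => ?_)
  simp only [smul_eq_mul, RCLike.inner_apply, conj_trivial]
  congr 2
  push_cast
  ring

lemma exp_phase_mul_exp_neg_phase {a : ℝ} (ha : a ≠ 0) (x ω t ξ : ℝ) :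
    Complex.exp (2 * Real.pi * Complex.I * ξ * t) *
      Complex.exp (-(2 * Real.pi * Complex.I * x * ξ)) =
    Complex.exp (2 * Real.pi * Complex.I * ω * (t - x : ℝ)) *
      Complex.exp (2 * Real.pi * Complex.I * (a * (ξ - ω) : ℝ) * ((t - x) / a : ℝ)) := by
  have ha' : (a : ℂ) ≠ 0 := by exact_mod_cast ha
  rw [← Complex.exp_add, ← Complex.exp_add]
  congr 1
  push_cast
  field_simp
  ring

lemma fourierInv_phase_mul_scaling (g : ℝ → ℂ) {a : ℝ} (ha : 0 < a) (x ω t : ℝ) :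
    𝓕⁻ (fun ξ : ℝ => Complex.exp (-(2 * Real.pi * Complex.I * x * ξ)) *
      ((√a : ℂ) * g (a * (ξ - ω)))) t =
    Complex.exp (2 * Real.pi * Complex.I * ω * (t - x : ℝ)) *
      (((1 / √a : ℝ) : ℂ) * 𝓕⁻ g ((t - x) / a)) := by
  let F : ℝ → ℂ := fun η => Complex.exp (2 * Real.pi * Complex.I * η * ((t - x) / a : ℝ)) * g η
  have hF (ξ : ℝ) : Complex.exp (2 * Real.pi * Complex.I * ξ * t) *
      (Complex.exp (-(2 * Real.pi * Complex.I * x * ξ)) * ((√a : ℂ) * g (a * (ξ - ω)))) =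
      Complex.exp (2 * Real.pi * Complex.I * ω * (t - x : ℝ)) * (√a : ℂ) * F (a * (ξ - ω)) := by
    rw [← mul_assoc, exp_phase_mul_exp_neg_phase ha.ne' x ω]
    ring
  have hsqrt : √a * a⁻¹ = 1 / √a := by rw [← div_eq_mul_inv, Real.sqrt_div_self']
  simp only [fourierInv_eq_integral, hF]
  rw [integral_const_mul, integral_sub_right_eq_self (fun ξ => F (a * ξ)),
    Measure.integral_comp_mul_left, abs_of_pos (inv_pos.2 ha), Complex.real_smul, ← hsqrt,
    Complex.ofReal_mul]
  ring

lemma dilation_ae {a : ℝ} (ha : 0 < a) {f : L2} {h : ℝ → ℂ} (hf : ⇑f =ᵐ[volume] h) :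
    ⇑(dilation a ha f) =ᵐ[volume] fun t => ((1 / √a : ℝ) : ℂ) * h (t / a) := by
  have hq : Measure.QuasiMeasurePreserving (fun t : ℝ => t / a) volume volume := by
    refine ⟨by fun_prop, ?_⟩
    simp only [div_eq_mul_inv]
    rw [Real.map_volume_mul_right (inv_ne_zero ha.ne')]
    exact Measure.smul_absolutelyContinuous
  filter_upwards [(memLp_dilation a ha f).coeFn_toLp, hq.ae hf] with t h1 h2
  rw [dilation, h1, h2]

lemma modulation_ae (ω : ℝ) {f : L2} {h : ℝ → ℂ} (hf : ⇑f =ᵐ[volume] h) :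
    ⇑(modulation ω f) =ᵐ[volume] fun t => Complex.exp (2 * Real.pi * Complex.I * ω * t) * h t := by
  filter_upwards [(memLp_modulation ω f).coeFn_toLp, hf] with t h1 h2
  rw [modulation, h1, h2]

lemma translation_ae (x : ℝ) {f : L2} {h : ℝ → ℂ} (hf : ⇑f =ᵐ[volume] h) :
    ⇑(translation x f) =ᵐ[volume] fun t => h (t - x) := by
  filter_upwards [(memLp_translation x f).coeFn_toLp,
    (measurePreserving_sub_right volume x).quasiMeasurePreserving.ae hf] with t h1 h2
  rw [translation, h1, h2]

lemma atom_ae (α : ℝ) (z : X) {f : L2} {h : ℝ → ℂ} (hf : ⇑f =ᵐ[volume] h) :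
    ⇑(atom α f z) =ᵐ[volume] fun t =>
      Complex.exp (2 * Real.pi * Complex.I * z.2 * (t - z.1 : ℝ)) *
        (((1 / √(beta α z.2) : ℝ) : ℂ) * h ((t - z.1) / beta α z.2)) := by
  rw [show atom α f z =
    translation z.1 (modulation z.2 (dilation (beta α z.2) (beta_pos α z.2) f)) by
      simp [atom, rep, sect]]
  exact translation_ae _ (modulation_ae _ (dilation_ae _ hf))

theorem IsWindow.fourier_atom_ae (hr : 1 < r) (h : IsWindow r C ψ g) (z : X) :
    ⇑(𝓕 (atom α ψ z) : L2) =ᵐ[volume]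
      fun ξ => Complex.exp (-(2 * Real.pi * Complex.I * z.1 * ξ)) * profile α g z.2 ξ := by
  set Q : ℝ → ℂ := fun ξ => Complex.exp (-(2 * Real.pi * Complex.I * z.1 * ξ)) *
    profile α g z.2 ξ with hQ
  have hnorm (ξ : ℝ) : ‖Q ξ‖ = ‖profile α g z.2 ξ‖ := by
    rw [hQ, norm_mul, norm_exp_neg_phase, one_mul]
  have hcont : Continuous Q := (by fun_prop : Continuous fun ξ : ℝ =>
    Complex.exp (-(2 * Real.pi * Complex.I * z.1 * ξ))).mul
      ((continuous_profile h.differentiable.continuous).comp (Continuous.prodMk_right z.2))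
  have hQ1 : Integrable Q := (integrable_profile (h.integrable hr) z.2).mono
    hcont.aestronglyMeasurable (.of_forall fun ξ => (hnorm ξ).le)
  have hQ2 : MemLp Q 2 := by
    rw [memLp_two_iff_integrable_sq_norm hcont.aestronglyMeasurable]
    simp only [hnorm]
    exact integrable_profile_norm_sq h.integrable_norm_sq z.2
  have hatom : atom α ψ z = (𝓕⁻ (hQ2.toLp Q) : L2) := by
    refine Lp.ext ?_
    filter_upwards [atom_ae α z (h.ae_eq_fourierInv hr), fourierInv_toLp_ae hQ1 hQ2] with t h1 h2
    rw [h2, h1]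
    exact (fourierInv_phase_mul_scaling g (beta_pos α z.2) z.1 z.2 t).symm
  rw [hatom, FourierTransform.fourier_fourierInv_eq]
  exact hQ2.coeFn_toLp

lemma wdist_le_one_add_beta_mul (hα0 : 0 ≤ α) (hα1 : α < 1) (ω ξ : ℝ) :
    wdist α ω ξ ≤ 3 / (1 - α) * (1 + beta α ω * |ω - ξ|) := by
  have h3 : 1 ≤ 3 / (1 - α) := by rw [one_le_div (by linarith)]; linarith
  rw [mul_one_add, wdist]
  exact add_le_add h3 (abs_warp_sub_warp_le hα0 hα1 ω ξ)

lemma decay_le_wdist (hα0 : 0 ≤ α) (hα1 : α < 1) (hr : 0 ≤ r) (ω ξ : ℝ) :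
    (1 + |beta α ω * (ξ - ω)|) ^ (-r) ≤ (3 / (1 - α)) ^ r * wdist α ω ξ ^ (-r) := by
  have h3 : 0 < 3 / (1 - α) := div_pos three_pos (by linarith)
  have hD := wdist_pos α ω ξ
  rw [abs_mul, abs_of_pos (beta_pos α ω), abs_sub_comm]
  calc (1 + beta α ω * |ω - ξ|) ^ (-r) ≤ (wdist α ω ξ / (3 / (1 - α))) ^ (-r) :=
        Real.rpow_le_rpow_of_nonpos (div_pos hD h3)
          ((div_le_iff₀' h3).2 (wdist_le_one_add_beta_mul hα0 hα1 ω ξ)) (by linarith)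
    _ = _ := by rw [Real.div_rpow hD.le h3.le, Real.rpow_neg h3.le, div_inv_eq_mul, mul_comm]

theorem IsWindow.isMolecule_atom (hα0 : 0 ≤ α) (hα1 : α < 1) (hr : 1 < r)
    (h : IsWindow r C ψ g) :
    IsMolecule α r (C * (3 / (1 - α)) ^ r) (atom α ψ) (profile α g) := by
  have hdecay (ω ξ : ℝ) := mul_le_mul_of_nonneg_left
    (decay_le_wdist hα0 hα1 (by linarith : 0 ≤ r) ω ξ) h.nonneg
  refine ⟨continuous_profile h.differentiable.continuous,
    fun ω ξ => (hasDerivAt_profile h.differentiable ω ξ).differentiableAt, fun ω ξ => ?_,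
    fun ω ξ => ?_, h.fourier_atom_ae hr⟩
  · rw [norm_profile]
    calc _ ≤ _ := mul_le_mul_of_nonneg_left ((h.norm_le _).trans (hdecay ω ξ))
          (Real.sqrt_nonneg _)
      _ = _ := by ring
  · have hβ := (beta_pos α ω).le
    rw [(hasDerivAt_profile h.differentiable ω ξ).deriv, norm_mul, norm_mul, Complex.norm_real,
      Complex.norm_real, Real.norm_of_nonneg (Real.sqrt_nonneg _), Real.norm_of_nonneg hβ]
    calc _ ≤ _ := mul_le_mul_of_nonneg_left (mul_le_mul_of_nonneg_left
          ((h.norm_deriv_le _).trans (hdecay ω ξ)) hβ) (Real.sqrt_nonneg _)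
      _ = _ := by ring

end Window

section FrameSymbol

lemma eLpNorm_two_sq {Ω E : Type*} [MeasurableSpace Ω] [NormedAddCommGroup E] (μ : Measure Ω)
    (f : Ω → E) : eLpNorm f 2 μ ^ 2 = ∫⁻ x, ‖f x‖ₑ ^ 2 ∂μ := by
  simpa using eLpNorm_nnreal_pow_eq_lintegral (f := f) (μ := μ) (p := 2) two_ne_zero

lemma memLp_two_of_lintegral_sq_lt_top {Ω E : Type*} [MeasurableSpace Ω] [NormedAddCommGroup E]
    {μ : Measure Ω} {f : Ω → E} (hf : AEStronglyMeasurable f μ)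
    (h : ∫⁻ x, ‖f x‖ₑ ^ 2 ∂μ < ∞) : MemLp f 2 μ := by
  rw [← eLpNorm_two_sq, ENNReal.pow_lt_top_iff] at h
  exact ⟨hf, h.resolve_right two_ne_zero⟩

lemma ip_conj (f g : L2) : starRingEnd ℂ (ip f g) = ip g f := inner_conj_symm _ _

/-- The symbol of the frame operator of molecules with profile `P`, a Fourier multiplier. -/
noncomputable def frameSymbol (P : ℝ → ℝ → ℂ) (ξ : ℝ) : ℂ :=
  ∫ ω, P ω ξ * starRingEnd ℂ (P ω ξ)

variable {α t C : ℝ} {e : X → L2} {P : ℝ → ℝ → ℂ}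

lemma IsMolecule.norm_sq_le (he : IsMolecule α t C e P) (ω ξ : ℝ) :
    ‖P ω ξ‖ ^ 2 ≤ C ^ 2 * (beta α ω * wdist α ω ξ ^ (-(2 * t))) := by
  refine (pow_le_pow_left₀ (norm_nonneg _) (he.norm_le ω ξ) 2).trans_eq ?_
  rw [mul_pow, mul_pow, Real.sq_sqrt (beta_pos α ω).le, rpow_neg_sq (wdist_pos ..).le, mul_assoc]

lemma IsMolecule.lintegral_sq_le (ht : 1 < 2 * t) (he : IsMolecule α t C e P) (ξ : ℝ) :
    ∫⁻ ω, ‖P ω ξ‖ₑ ^ 2 ≤ ENNReal.ofReal (C ^ 2 * decayInt (2 * t)) := by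
  calc ∫⁻ ω, ‖P ω ξ‖ₑ ^ 2
      ≤ ∫⁻ ω, ENNReal.ofReal (C ^ 2) *
          ENNReal.ofReal (beta α ω * wdist α ω ξ ^ (-(2 * t))) := by
        refine lintegral_mono fun ω => ?_
        rw [← ofReal_norm, ← ENNReal.ofReal_pow (norm_nonneg _),
          ← ENNReal.ofReal_mul (sq_nonneg C)]
        exact ENNReal.ofReal_le_ofReal (he.norm_sq_le ω ξ)
    _ ≤ ENNReal.ofReal (C ^ 2) * ENNReal.ofReal (decayInt (2 * t)) := by
        rw [lintegral_const_mul' _ _ ENNReal.ofReal_ne_top]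
        exact mul_le_mul_right (lintegral_beta_mul_wdist_le ht α ξ) _
    _ = _ := (ENNReal.ofReal_mul (sq_nonneg C)).symm

lemma IsMolecule.norm_le_const (hα0 : 0 ≤ α) (ht : 0 ≤ t) (he : IsMolecule α t C e P)
    (ω ξ : ℝ) : ‖P ω ξ‖ ≤ C := by
  have hC := he.nonneg
  have hβ : √(beta α ω) ≤ 1 := Real.sqrt_le_one.2 (beta_le_one hα0 ω)
  have hD0 := wdist_rpow_nonneg α ω ξ (-t)
  have hD : wdist α ω ξ ^ (-t) ≤ 1 :=
    Real.rpow_le_one_of_one_le_of_nonpos (one_le_wdist ..) (neg_nonpos.2 ht)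
  calc ‖P ω ξ‖ ≤ C * √(beta α ω) * wdist α ω ξ ^ (-t) := he.norm_le ω ξ
    _ ≤ C * 1 * 1 := by gcongr
    _ = C := by ring

lemma IsMolecule.ip_eq_fourierInv (he : IsMolecule α t C e P) (f : L2) (x ω : ℝ) :
    ip f (e (x, ω)) = 𝓕⁻ (fun ξ => (𝓕 f : L2) ξ * starRingEnd ℂ (P ω ξ)) x := by
  rw [he.ip_right, fourierInv_eq_integral]
  refine integral_congr_ae (.of_forall fun ξ => ?_)
  simp only
  rw [mul_right_comm _ (x : ℂ)]

lemma IsMolecule.integrable_fourier_mul (he : IsMolecule α t C e P) (f : L2) (ω : ℝ) :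
    Integrable fun ξ => (𝓕 f : L2) ξ * starRingEnd ℂ (P ω ξ) :=
  (Lp.memLp (𝓕 f : L2)).integrable_mul (he.memLp_two ω).star

lemma IsMolecule.memLp_fourier_mul (hα0 : 0 ≤ α) (ht : 0 ≤ t) (he : IsMolecule α t C e P)
    (f : L2) (ω : ℝ) : MemLp (fun ξ => (𝓕 f : L2) ξ * starRingEnd ℂ (P ω ξ)) 2 := by
  refine (Lp.memLp (𝓕 f : L2)).of_le_mul (c := C)
    (he.integrable_fourier_mul f ω).aestronglyMeasurable (.of_forall fun ξ => ?_)
  rw [norm_mul, RCLike.norm_conj, mul_comm]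
  exact mul_le_mul_of_nonneg_right (he.norm_le_const hα0 ht ω ξ) (norm_nonneg _)

lemma IsMolecule.stronglyMeasurable_fourier_mul (he : IsMolecule α t C e P) (f : L2) :
    StronglyMeasurable fun p : ℝ × ℝ => (𝓕 f : L2) p.2 * starRingEnd ℂ (P p.1 p.2) :=
  ((Lp.stronglyMeasurable (𝓕 f : L2)).comp_measurable measurable_snd).mul
    (Complex.continuous_conj.comp he.continuous).stronglyMeasurable

lemma IsMolecule.lintegral_fourier_mul_lt_top (ht : 1 < 2 * t) (he : IsMolecule α t C e P)
    (f : L2) : ∫⁻ ω, ∫⁻ ξ, ‖(𝓕 f : L2) ξ * starRingEnd ℂ (P ω ξ)‖ₑ ^ 2 < ∞ := by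
  have hm : Measurable fun ξ => ‖(𝓕 f : L2) ξ‖ₑ ^ 2 :=
    (Lp.stronglyMeasurable (𝓕 f : L2)).measurable.enorm.pow_const 2
  rw [lintegral_lintegral_swap
    ((he.stronglyMeasurable_fourier_mul f).measurable.enorm.pow_const 2).aemeasurable]
  calc ∫⁻ ξ, ∫⁻ ω, ‖(𝓕 f : L2) ξ * starRingEnd ℂ (P ω ξ)‖ₑ ^ 2
      ≤ ∫⁻ ξ, ‖(𝓕 f : L2) ξ‖ₑ ^ 2 * ENNReal.ofReal (C ^ 2 * decayInt (2 * t)) := by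
        refine lintegral_mono fun ξ => ?_
        simp only [enorm_mul, mul_pow, RCLike.enorm_conj]
        rw [lintegral_const_mul' _ _ (ENNReal.pow_ne_top enorm_ne_top)]
        exact mul_le_mul_right (he.lintegral_sq_le ht ξ) _
    _ < ∞ := by
        rw [lintegral_mul_const _ hm, ← eLpNorm_two_sq]
        exact ENNReal.mul_lt_top (ENNReal.pow_lt_top (Lp.memLp (𝓕 f : L2)).eLpNorm_lt_top)
          ENNReal.ofReal_lt_top

lemma IsMolecule.memLp_fourier_mul_prod (ht : 1 < 2 * t) (he : IsMolecule α t C e P) (f : L2) :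
    MemLp (fun p : ℝ × ℝ => (𝓕 f : L2) p.2 * starRingEnd ℂ (P p.1 p.2)) 2 := by
  refine memLp_two_of_lintegral_sq_lt_top
    (he.stronglyMeasurable_fourier_mul f).aestronglyMeasurable ?_
  rw [Measure.volume_eq_prod, lintegral_prod _
    ((he.stronglyMeasurable_fourier_mul f).measurable.enorm.pow_const 2).aemeasurable]
  exact he.lintegral_fourier_mul_lt_top ht f

lemma IsMolecule.memLp_ip (hα0 : 0 ≤ α) (ht : 1 < 2 * t) (he : IsMolecule α t C e P) (f : L2) :
    MemLp (fun z => ip f (e z)) 2 := by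
  refine memLp_two_of_lintegral_sq_lt_top (he.stronglyMeasurable_ip f).aestronglyMeasurable ?_
  rw [Measure.volume_eq_prod, lintegral_prod_symm' _
    ((he.stronglyMeasurable_ip f).measurable.enorm.pow_const 2)]
  refine (lintegral_congr fun ω => ?_).trans_lt (he.lintegral_fourier_mul_lt_top ht f)
  simp only [he.ip_eq_fourierInv f]
  rw [← eLpNorm_two_sq, eLpNorm_fourierInv_eq (he.integrable_fourier_mul f ω)
    (he.memLp_fourier_mul hα0 (by linarith) f ω), eLpNorm_two_sq]

lemma IsMolecule.integrable_ip_mul_ip (hα0 : 0 ≤ α) (ht : 1 < 2 * t)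
    (he : IsMolecule α t C e P) (f h : L2) :
    Integrable fun z : X => ip f (e z) * ip (e z) h := by
  have hh : MemLp (fun z => ip (e z) h) 2 :=
    (he.memLp_ip hα0 ht h).star.ae_eq (.of_forall fun z => ip_conj h (e z))
  exact (he.memLp_ip hα0 ht f).integrable_mul hh

lemma IsMolecule.integral_ip_mul_ip_left (hα0 : 0 ≤ α) (ht : 0 ≤ t)
    (he : IsMolecule α t C e P) (f h : L2) (ω : ℝ) :
    ∫ x, ip f (e (x, ω)) * ip (e (x, ω)) h =
      ∫ ξ, P ω ξ * starRingEnd ℂ (P ω ξ) * ((𝓕 f : L2) ξ * starRingEnd ℂ ((𝓕 h : L2) ξ)) := by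
  have hparseval := integral_inner_fourierInv_eq (he.integrable_fourier_mul h ω)
    (he.memLp_fourier_mul hα0 ht h ω) (he.integrable_fourier_mul f ω)
    (he.memLp_fourier_mul hα0 ht f ω)
  simp only [← he.ip_eq_fourierInv, RCLike.inner_apply, ip_conj, map_mul, RCLike.conj_conj]
    at hparseval
  rw [hparseval]
  exact integral_congr_ae (.of_forall fun ξ => by ring)

theorem IsMolecule.integral_ip_mul_ip (hα0 : 0 ≤ α) (ht : 1 < 2 * t)
    (he : IsMolecule α t C e P) (f h : L2) :
    ∫ z : X, ip f (e z) * ip (e z) h =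
      ∫ ξ, frameSymbol P ξ * ((𝓕 f : L2) ξ * starRingEnd ℂ ((𝓕 h : L2) ξ)) := by
  have hint := he.integrable_ip_mul_ip hα0 ht f h
  have hprod : Integrable fun p : ℝ × ℝ => P p.1 p.2 * starRingEnd ℂ (P p.1 p.2) *
      ((𝓕 f : L2) p.2 * starRingEnd ℂ ((𝓕 h : L2) p.2)) := by
    refine ((he.memLp_fourier_mul_prod ht f).integrable_mul
      (he.memLp_fourier_mul_prod ht h).star).congr (.of_forall fun p => ?_)
    simp only [Pi.mul_apply, Pi.star_apply, RCLike.star_def, map_mul, RCLike.conj_conj]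
    ring
  rw [Measure.volume_eq_prod] at hint hprod
  rw [Measure.volume_eq_prod, integral_prod_symm _ hint]
  simp only [he.integral_ip_mul_ip_left hα0 (by linarith : 0 ≤ t)]
  rw [integral_integral_swap hprod]
  exact integral_congr_ae (.of_forall fun ξ => integral_mul_const _ _)

lemma IsMolecule.norm_frameSymbol_le (ht : 1 < 2 * t) (he : IsMolecule α t C e P) (ξ : ℝ) :
    ‖frameSymbol P ξ‖ ≤ C ^ 2 * decayInt (2 * t) := by
  refine (norm_integral_le_lintegral_norm _).trans (ENNReal.toReal_le_of_le_ofReal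
    (mul_nonneg (sq_nonneg C) (decayInt_nonneg _)) ((he.lintegral_sq_le ht ξ).trans' ?_))
  refine lintegral_mono fun ω => ?_
  rw [norm_mul, RCLike.norm_conj, ENNReal.ofReal_mul (norm_nonneg _), ofReal_norm, sq]

lemma integrable_beta_mul_wdist {N : ℝ} (hN : 1 < N) (α ξ : ℝ) :
    Integrable fun ω => beta α ω * wdist α ω ξ ^ (-N) := by
  have hm : Measurable fun ω => beta α ω * wdist α ω ξ ^ (-N) := by
    simp only [wdist_comm α _ ξ]
    exact (continuous_beta α).measurable.mul ((continuous_wdist α ξ).measurable.pow_const _)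
  refine ⟨hm.aestronglyMeasurable, ?_⟩
  rw [hasFiniteIntegral_iff_ofReal (.of_forall fun ω =>
    mul_nonneg (beta_pos α ω).le (wdist_rpow_nonneg ..))]
  exact (lintegral_beta_mul_wdist_le hN α ξ).trans_lt ENNReal.ofReal_lt_top

lemma IsMolecule.norm_deriv_normSq_le (he : IsMolecule α t C e P) (ω ξ : ℝ) :
    ‖deriv (fun ξ => P ω ξ * starRingEnd ℂ (P ω ξ)) ξ‖ ≤
      2 * C ^ 2 * beta α ω * (beta α ω * wdist α ω ξ ^ (-(2 * t))) := by
  refine (he.norm_deriv_mul_conj_le he ω ω ξ).trans_eq ?_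
  rw [Real.mul_self_sqrt (beta_pos α ω).le, ← rpow_neg_sq (wdist_pos ..).le]
  ring

lemma IsMolecule.continuous_normSq (he : IsMolecule α t C e P) :
    Continuous fun p : ℝ × ℝ => P p.1 p.2 * starRingEnd ℂ (P p.1 p.2) :=
  he.continuous.mul (Complex.continuous_conj.comp he.continuous)

lemma wdist_rpow_neg_le_of_abs_sub_le (hα0 : 0 ≤ α) (hα1 : α < 1) {N : ℝ} (hN : 0 ≤ N)
    {ω ξ ξ₀ : ℝ} (h : |ξ - ξ₀| ≤ 1) :
    wdist α ω ξ ^ (-N) ≤ (1 + 3 / (1 - α)) ^ N * wdist α ω ξ₀ ^ (-N) := by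
  have hK : 0 ≤ 3 / (1 - α) := div_nonneg zero_le_three (sub_nonneg.2 hα1.le)
  have hD := wdist_pos α ω ξ₀
  have hle : wdist α ω ξ₀ ≤ (1 + 3 / (1 - α)) * wdist α ω ξ := by
    have hwarp : |warp α ξ - warp α ξ₀| ≤ 3 / (1 - α) :=
      (abs_warp_sub_warp_le hα0 hα1 ξ ξ₀).trans <| mul_le_of_le_one_right hK <|
        mul_le_one₀ (beta_le_one hα0 ξ) (abs_nonneg _) h
    calc wdist α ω ξ₀ ≤ wdist α ω ξ + 3 / (1 - α) := by
          unfold wdist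
          linarith [abs_sub_le (warp α ω) (warp α ξ) (warp α ξ₀)]
      _ ≤ wdist α ω ξ + 3 / (1 - α) * wdist α ω ξ := by
          gcongr
          exact le_mul_of_one_le_right hK (one_le_wdist ..)
      _ = _ := by ring
  calc wdist α ω ξ ^ (-N) ≤ (wdist α ω ξ₀ / (1 + 3 / (1 - α))) ^ (-N) :=
        Real.rpow_le_rpow_of_nonpos (by positivity) ((div_le_iff₀' (by positivity)).2 hle)
          (neg_nonpos.2 hN)
    _ = _ := by
        rw [Real.div_rpow hD.le (by positivity),
          Real.rpow_neg (by positivity : 0 ≤ 1 + 3 / (1 - α)), div_inv_eq_mul, mul_comm]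

theorem IsMolecule.hasDerivAt_frameSymbol (hα0 : 0 ≤ α) (hα1 : α < 1) (ht : 1 < 2 * t)
    (he : IsMolecule α t C e P) (ξ₀ : ℝ) :
    HasDerivAt (frameSymbol P)
      (∫ ω, deriv (fun ξ => P ω ξ * starRingEnd ℂ (P ω ξ)) ξ₀) ξ₀ := by
  have hdiff (ω : ℝ) : Differentiable ℝ fun ξ => P ω ξ * starRingEnd ℂ (P ω ξ) := fun ξ =>
    (hasDerivAt_mul_conj (he.differentiable ω) (he.differentiable ω) ξ).differentiableAt
  have hcont (ξ : ℝ) : Continuous fun ω => P ω ξ * starRingEnd ℂ (P ω ξ) :=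
    he.continuous_normSq.comp (Continuous.prodMk_left ξ)
  have hbound := integrable_beta_mul_wdist ht α ξ₀
  refine (hasDerivAt_integral_of_dominated_loc_of_deriv_le
    (bound := fun ω => 2 * C ^ 2 * (1 + 3 / (1 - α)) ^ (2 * t) *
      (beta α ω * wdist α ω ξ₀ ^ (-(2 * t))))
    (Metric.ball_mem_nhds ξ₀ one_pos) (.of_forall fun ξ => (hcont ξ).aestronglyMeasurable)
    ((hbound.const_mul (C ^ 2)).mono' (hcont ξ₀).aestronglyMeasurable (.of_forall fun ω => ?_))
    ?_ (.of_forall fun ω ξ hξ => ?_) (hbound.const_mul _)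
    (.of_forall fun ω ξ _ => (hdiff ω ξ).hasDerivAt)).2
  · rw [norm_mul, RCLike.norm_conj, ← sq]
    exact he.norm_sq_le ω ξ₀
  · exact ((measurable_deriv_with_param
      (f := fun ω ξ => P ω ξ * starRingEnd ℂ (P ω ξ)) he.continuous_normSq).comp
      (measurable_prodMk_right (y := ξ₀))).aestronglyMeasurable
  · have hβ := beta_pos α ω
    have hD := wdist_rpow_nonneg α ω ξ (-(2 * t))
    calc _ ≤ 2 * C ^ 2 * beta α ω * (beta α ω * wdist α ω ξ ^ (-(2 * t))) :=
          he.norm_deriv_normSq_le ω ξ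
      _ ≤ 2 * C ^ 2 * 1 * (beta α ω *
            ((1 + 3 / (1 - α)) ^ (2 * t) * wdist α ω ξ₀ ^ (-(2 * t)))) := by
          gcongr
          · exact beta_le_one hα0 ω
          · exact wdist_rpow_neg_le_of_abs_sub_le hα0 hα1 (by linarith)
              (Metric.mem_ball.1 hξ).le
      _ = _ := by ring

theorem IsMolecule.norm_deriv_frameSymbol_le (hα0 : 0 ≤ α) (hα1 : α < 1)
    (ht : 1 + α / (1 - α) < 2 * t) (he : IsMolecule α t C e P) (ξ : ℝ) :
    ‖deriv (frameSymbol P) ξ‖ ≤ 2 * C ^ 2 * decayInt (2 * t - α / (1 - α)) * beta α ξ := by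
  have hα : 0 ≤ α / (1 - α) := div_nonneg hα0 (by linarith)
  have hβ := beta_pos α ξ
  have hI := decayInt_nonneg (2 * t - α / (1 - α))
  rw [(he.hasDerivAt_frameSymbol hα0 hα1 (by linarith) ξ).deriv]
  refine (norm_integral_le_lintegral_norm _).trans
    (ENNReal.toReal_le_of_le_ofReal (by positivity) ?_)
  calc _ ≤ ∫⁻ ω, ENNReal.ofReal (2 * C ^ 2 * beta α ξ) *
        ENNReal.ofReal (beta α ω * wdist α ω ξ ^ (-(2 * t - α / (1 - α)))) := by
        refine lintegral_mono fun ω => ?_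
        have hβω := beta_pos α ω
        have hD := wdist_rpow_nonneg α ω ξ (-(2 * t))
        rw [← ENNReal.ofReal_mul (by positivity)]
        refine ENNReal.ofReal_le_ofReal ((he.norm_deriv_normSq_le ω ξ).trans ?_)
        rw [show -(2 * t - α / (1 - α)) = α / (1 - α) + -(2 * t) by ring,
          Real.rpow_add (wdist_pos ..)]
        calc _ ≤ 2 * C ^ 2 * (beta α ξ * wdist α ω ξ ^ (α / (1 - α))) *
              (beta α ω * wdist α ω ξ ^ (-(2 * t))) := by
              gcongr
              exact beta_le hα0 hα1 ω ξ
          _ = _ := by ring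
    _ ≤ ENNReal.ofReal (2 * C ^ 2 * beta α ξ) *
          ENNReal.ofReal (decayInt (2 * t - α / (1 - α))) := by
        rw [lintegral_const_mul' _ _ ENNReal.ofReal_ne_top]
        exact mul_le_mul_right (lintegral_beta_mul_wdist_le (by linarith) α ξ) _
    _ = _ := by
        rw [← ENNReal.ofReal_mul (by positivity)]
        ring_nf

end FrameSymbol

section Admissible

variable {α t r C : ℝ} {ψ φ : L2} {g : ℝ → ℂ} {e : X → L2} {P : ℝ → ℝ → ℂ}

lemma tendsto_beta_mul_sub_atTop (hα0 : 0 ≤ α) (hα1 : α < 1) (ξ : ℝ) :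
    Filter.Tendsto (fun ω => beta α ω * (ω - ξ)) Filter.atTop Filter.atTop := by
  have hpow : Filter.Tendsto (fun ω : ℝ => (1 + ω) ^ (1 - α) - (1 + |ξ|))
      Filter.atTop Filter.atTop :=
    Filter.tendsto_atTop_add_const_right _ _ ((tendsto_rpow_atTop (by linarith)).comp
      (Filter.tendsto_atTop_add_const_left _ _ Filter.tendsto_id))
  refine Filter.tendsto_atTop_mono' _ ?_ hpow
  filter_upwards [Filter.eventually_ge_atTop 0] with ω hω
  have hβ : beta α ω * (1 + ω) = (1 + ω) ^ (1 - α) := by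
    rw [beta, abs_of_nonneg hω, ← Real.rpow_add_one (by positivity), neg_add_eq_sub]
  have hξ : beta α ω * (1 + |ξ|) ≤ 1 + |ξ| :=
    mul_le_of_le_one_left (by positivity) (beta_le_one hα0 ω)
  have hξ' := mul_le_mul_of_nonneg_left (le_abs_self ξ) (beta_pos α ω).le
  linarith

lemma exists_beta_mul_sub_eq (hα0 : 0 ≤ α) (hα1 : α < 1) (ξ t₀ : ℝ) :
    ∃ ω, beta α ω * (ξ - ω) = t₀ := by
  have hbot : Filter.Tendsto (fun ω => beta α ω * (ω - ξ)) Filter.atBot Filter.atBot := by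
    refine (Filter.tendsto_neg_atTop_atBot.comp ((tendsto_beta_mul_sub_atTop hα0 hα1 (-ξ)).comp
      Filter.tendsto_neg_atBot_atTop)).congr fun ω => ?_
    simp only [Function.comp_apply, beta_neg]
    ring
  obtain ⟨ω, hω⟩ := ((continuous_beta α).mul (continuous_id.sub continuous_const)).surjective
    (tendsto_beta_mul_sub_atTop hα0 hα1 ξ) hbot (-t₀)
  exact ⟨ω, by rw [← neg_sub, mul_neg]; exact neg_eq_iff_eq_neg.2 hω⟩

lemma abs_beta_div_sub_one_le (hα0 : 0 ≤ α) (hα1 : α ≤ 1) (ω ω₀ : ℝ) :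
    |beta α ω₀ / beta α ω - 1| ≤ beta α ω₀ * |ω - ω₀| := by
  have hA : 0 < 1 + |ω₀| := by positivity
  have hB : 0 < 1 + |ω| := by positivity
  have heq : beta α ω₀ / beta α ω - 1 =
      -(beta α ω₀ * ((1 + |ω₀|) ^ α - (1 + |ω|) ^ α)) := by
    rw [beta, beta, Real.rpow_neg hA.le, Real.rpow_neg hB.le, mul_sub,
      inv_mul_cancel₀ (Real.rpow_pos_of_pos hA α).ne', div_inv_eq_mul]
    ring
  have hone : (1 + |ω₀|) ^ (α - 1) ≤ 1 :=
    Real.rpow_le_one_of_one_le_of_nonpos (by linarith [abs_nonneg ω₀]) (by linarith)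
  have habs : |1 + |ω₀| - (1 + |ω|)| ≤ |ω - ω₀| := by
    rw [add_sub_add_left_eq_sub, abs_sub_comm ω]
    exact abs_abs_sub_abs_le _ _
  rw [heq, abs_neg, abs_mul, abs_of_pos (beta_pos α ω₀)]
  refine mul_le_mul_of_nonneg_left ?_ (beta_pos α ω₀).le
  calc _ ≤ _ := abs_rpow_sub_rpow_le hα0 hα1 hA hB
    _ ≤ 1 * |ω - ω₀| := mul_le_mul hone habs (abs_nonneg _) zero_le_one
    _ = _ := one_mul _

lemma half_beta_le (hα0 : 0 ≤ α) (hα1 : α ≤ 1) {ω ω₀ : ℝ}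
    (h : beta α ω₀ * |ω - ω₀| ≤ 1 / 2) : beta α ω₀ / 2 ≤ beta α ω := by
  have hβ := beta_pos α ω
  have hy := (abs_le.1 ((abs_beta_div_sub_one_le hα0 hα1 ω ω₀).trans h)).2
  rw [sub_le_iff_le_add, div_le_iff₀ hβ] at hy
  linarith

lemma abs_beta_mul_sub_sub_le (hα0 : 0 ≤ α) (hα1 : α ≤ 1) {ω ω₀ η : ℝ} (ξ : ℝ)
    (hη : η ≤ 1 / 2) (h : beta α ω₀ * |ω - ω₀| ≤ η) :
    |beta α ω * (ξ - ω) - beta α ω₀ * (ξ - ω₀)| ≤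
      2 * η * (|beta α ω₀ * (ξ - ω₀)| + 1) := by
  have hβ := beta_pos α ω
  have hβ₀ := beta_pos α ω₀
  set t₀ := beta α ω₀ * (ξ - ω₀) with ht₀
  set y := beta α ω₀ / beta α ω with hydef
  have hy := (abs_beta_div_sub_one_le hα0 hα1 ω ω₀).trans h
  have hy2 : 1 / 2 ≤ y := by linarith [(abs_le.1 hy).1]
  have hy0 : 0 < y := by linarith
  have heq : beta α ω * (ξ - ω) - t₀ = (t₀ * (1 - y) + beta α ω₀ * (ω₀ - ω)) / y := by
    rw [ht₀, hydef]
    field_simp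
    ring
  have h1 : |t₀ * (1 - y)| ≤ |t₀| * η := by
    rw [abs_mul, abs_sub_comm]
    exact mul_le_mul_of_nonneg_left hy (abs_nonneg _)
  have h2 : |beta α ω₀ * (ω₀ - ω)| ≤ η := by
    rwa [abs_mul, abs_of_pos hβ₀, abs_sub_comm]
  have hη0 : 0 ≤ η := (abs_nonneg _).trans h2
  rw [heq, abs_div, abs_of_pos hy0, div_le_iff₀ hy0]
  calc |t₀ * (1 - y) + beta α ω₀ * (ω₀ - ω)|
      ≤ |t₀| * η + η := (abs_add_le _ _).trans (add_le_add h1 h2)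
    _ = 2 * η * (|t₀| + 1) * (1 / 2) := by ring
    _ ≤ _ := mul_le_mul_of_nonneg_left hy2 (by positivity)

lemma le_norm_sq_profile (hα0 : 0 ≤ α) (hα1 : α ≤ 1) {ω ω₀ ξ η ε δ : ℝ} (hδ : 0 ≤ δ)
    (hη : η ≤ 1 / 2) (hηε : 2 * η * (|beta α ω₀ * (ξ - ω₀)| + 1) < ε)
    (hg : ∀ t, |t - beta α ω₀ * (ξ - ω₀)| < ε → δ ≤ ‖g t‖) (h : beta α ω₀ * |ω - ω₀| ≤ η) :
    beta α ω₀ / 2 * δ ^ 2 ≤ ‖profile α g ω ξ‖ ^ 2 := by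
  rw [norm_profile, mul_pow, Real.sq_sqrt (beta_pos α ω).le]
  exact mul_le_mul (half_beta_le hα0 hα1 (h.trans hη))
    (pow_le_pow_left₀ hδ (hg _ ((abs_beta_mul_sub_sub_le hα0 hα1 ξ hη h).trans_lt hηε)) 2)
    (sq_nonneg δ) (beta_pos α ω).le

lemma exists_le_integral_profile (hα0 : 0 ≤ α) (hα1 : α < 1) (hg : Continuous g) {t₀ : ℝ}
    (ht₀ : g t₀ ≠ 0) (hint : ∀ ξ, Integrable fun ω => ‖profile α g ω ξ‖ ^ 2) :
    ∃ c, 0 < c ∧ ∀ ξ, c ≤ ∫ ω, ‖profile α g ω ξ‖ ^ 2 := by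
  set δ : ℝ := ‖g t₀‖ / 2
  have hδ : 0 < δ := half_pos (norm_pos_iff.2 ht₀)
  obtain ⟨ε, hε, hgε⟩ : ∃ ε > 0, ∀ t, |t - t₀| < ε → δ ≤ ‖g t‖ :=
    Metric.eventually_nhds_iff.1 ((hg.norm.continuousAt.eventually_const_lt
      (half_lt_self (norm_pos_iff.2 ht₀))).mono fun _ => le_of_lt)
  obtain ⟨η, hη, hηε, hη2⟩ : ∃ η > 0, 2 * η * (|t₀| + 1) < ε ∧ η ≤ 1 / 2 := by
    refine ⟨min (1 / 2) (ε / (4 * (|t₀| + 1))), lt_min (by norm_num) (by positivity), ?_,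
      min_le_left _ _⟩
    have := (le_div_iff₀ (by positivity)).1 (min_le_right (1 / 2) (ε / (4 * (|t₀| + 1))))
    linarith
  refine ⟨η * δ ^ 2, by positivity, fun ξ => ?_⟩
  obtain ⟨ω₀, hω₀⟩ := exists_beta_mul_sub_eq hα0 hα1 ξ t₀
  have hβ₀ := beta_pos α ω₀
  set S := Metric.closedBall ω₀ (η / beta α ω₀) with hS
  have hlow : ∀ ω ∈ S, beta α ω₀ / 2 * δ ^ 2 ≤ ‖profile α g ω ξ‖ ^ 2 := fun ω hω => by
    rw [hS, Metric.mem_closedBall, Real.dist_eq, le_div_iff₀' hβ₀] at hω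
    exact le_norm_sq_profile hα0 hα1.le hδ.le hη2 (by rwa [hω₀]) (by rwa [hω₀]) hω
  calc η * δ ^ 2 = ∫ ω in S, beta α ω₀ / 2 * δ ^ 2 := by
        rw [setIntegral_const, hS, Real.volume_real_closedBall (by positivity), smul_eq_mul]
        field_simp
    _ ≤ ∫ ω in S, ‖profile α g ω ξ‖ ^ 2 :=
        setIntegral_mono_on (integrableOn_const measure_closedBall_lt_top.ne enorm_ne_top)
          (hint ξ).integrableOn measurableSet_closedBall hlow
    _ ≤ ∫ ω, ‖profile α g ω ξ‖ ^ 2 :=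
        setIntegral_le_integral (hint ξ) (.of_forall fun ω => sq_nonneg _)

lemma norm_frameSymbol (P : ℝ → ℝ → ℂ) (ξ : ℝ) :
    ‖frameSymbol P ξ‖ = ∫ ω, ‖P ω ξ‖ ^ 2 := by
  have hreal : frameSymbol P ξ = ((∫ ω, ‖P ω ξ‖ ^ 2 : ℝ) : ℂ) := by
    rw [frameSymbol, ← integral_complex_ofReal]
    simp only [Complex.mul_conj, Complex.normSq_eq_norm_sq]
  rw [hreal, Complex.norm_real, Real.norm_of_nonneg (integral_nonneg fun ω => sq_nonneg _)]

lemma IsMolecule.integrable_norm_sq (ht : 1 < 2 * t) (he : IsMolecule α t C e P) (ξ : ℝ) :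
    Integrable fun ω => ‖P ω ξ‖ ^ 2 := by
  refine ((integrable_beta_mul_wdist ht α ξ).const_mul (C ^ 2)).mono'
    ((he.continuous.comp (Continuous.prodMk_left ξ)).norm.pow 2).aestronglyMeasurable
    (.of_forall fun ω => ?_)
  rw [Real.norm_of_nonneg (sq_nonneg _)]
  exact he.norm_sq_le ω ξ

lemma IsWindow.exists_ne_zero (h : IsWindow r C ψ g) (hψ : ψ ≠ 0) : ∃ t₀, g t₀ ≠ 0 := by
  by_contra! hg
  refine hψ (fourier_injective (Lp.ext (h.fourier_ae.trans ?_)))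
  rw [show (𝓕 (0 : L2) : L2) = 0 from (Lp.fourierTransformₗᵢ ℝ ℂ).map_zero]
  filter_upwards [Lp.coeFn_zero ℂ 2 (volume : Measure ℝ)] with ξ hξ
  rw [hg ξ, hξ, Pi.zero_apply]

lemma IsWindow.exists_le_norm_frameSymbol (hα0 : 0 ≤ α) (hα1 : α < 1) (hr : 1 < r)
    (h : IsWindow r C ψ g) (hψ : ψ ≠ 0) :
    ∃ c, 0 < c ∧ ∀ ξ, c ≤ ‖frameSymbol (profile α g) ξ‖ := by
  obtain ⟨t₀, ht₀⟩ := h.exists_ne_zero hψ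
  simp only [norm_frameSymbol]
  exact exists_le_integral_profile hα0 hα1 h.differentiable.continuous ht₀
    ((h.isMolecule_atom hα0 hα1 hr).integrable_norm_sq (by linarith))

lemma IsMolecule.exists_isSymbol_frameSymbol (hα0 : 0 ≤ α) (hα1 : α < 1)
    (ht : 1 + α / (1 - α) < 2 * t) (he : IsMolecule α t C e P) :
    ∃ b : ℝ →ᵇ ℂ, IsSymbol α b ∧ ⇑b = frameSymbol P := by
  have ht1 : 1 < 2 * t := by linarith [div_nonneg hα0 (sub_nonneg.2 hα1.le)]
  have hd : Differentiable ℝ (frameSymbol P) := fun ξ =>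
    (he.hasDerivAt_frameSymbol hα0 hα1 ht1 ξ).differentiableAt
  exact ⟨BoundedContinuousFunction.ofNormedAddCommGroup _ hd.continuous _
    (he.norm_frameSymbol_le ht1), ⟨hd, _, he.norm_deriv_frameSymbol_le hα0 hα1 ht⟩, rfl⟩

lemma IsSymbol.exists_inverse {b : ℝ →ᵇ ℂ} (hb : IsSymbol α b) {m : ℝ} (hm : 0 < m)
    (hlow : ∀ ξ, m ≤ ‖b ξ‖) : ∃ c : ℝ →ᵇ ℂ, IsSymbol α c ∧ b * c = 1 := by
  obtain ⟨B, hB⟩ := hb.exists_norm_deriv_le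
  have hne (ξ : ℝ) : b ξ ≠ 0 := norm_pos_iff.1 (hm.trans_le (hlow ξ))
  let c : ℝ →ᵇ ℂ := BoundedContinuousFunction.ofNormedAddCommGroup (fun ξ => (b ξ)⁻¹)
    (b.continuous.inv₀ hne) m⁻¹ fun ξ => by
      rw [norm_inv]
      exact inv_anti₀ hm (hlow ξ)
  have hder (ξ : ℝ) : HasDerivAt c (-deriv b ξ / b ξ ^ 2) ξ :=
    (hb.differentiable ξ).hasDerivAt.inv (hne ξ)
  refine ⟨c, ⟨fun ξ => (hder ξ).differentiableAt, B * (m ^ 2)⁻¹, fun ξ => ?_⟩, ?_⟩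
  · rw [(hder ξ).deriv, norm_div, norm_neg, norm_pow, div_eq_mul_inv, mul_right_comm]
    exact mul_le_mul (hB ξ) (inv_anti₀ (by positivity) (pow_le_pow_left₀ hm.le (hlow ξ) 2))
      (by positivity) ((norm_nonneg _).trans (hB ξ))
  · ext ξ
    exact mul_inv_cancel₀ (hne ξ)

theorem IsWindow.exists_isFrameOperator (hα0 : 0 ≤ α) (hα1 : α < 1) (hr : 1 < r)
    (hr' : 1 + α / (1 - α) < 2 * r) (h : IsWindow r C ψ g) (hψ : ψ ≠ 0) :
    ∃ b c : ℝ →ᵇ ℂ, IsSymbol α c ∧ b * c = 1 ∧ IsFrameOperator α ψ (fmul b) := by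
  have he := h.isMolecule_atom hα0 hα1 hr
  obtain ⟨m, hm, hlow⟩ := h.exists_le_norm_frameSymbol hα0 hα1 hr hψ
  obtain ⟨b, hb, hbP⟩ := he.exists_isSymbol_frameSymbol hα0 hα1 hr'
  obtain ⟨c, hc, hbc⟩ := hb.exists_inverse hm (by rwa [hbP])
  refine ⟨b, c, hc, hbc, fun f h => ⟨he.integrable_ip_mul_ip hα0 (by linarith) f h, ?_⟩⟩
  rw [he.integral_ip_mul_ip hα0 (by linarith), ip_fmul, hbP]

/-- `(d, e)` is a pair of dual families: `f = ∫ ⟨f, d(y)⟩ e(y) dy` weakly. -/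
def IsDualPair (d e : X → L2) : Prop :=
  ∀ f h : L2, Integrable (fun y : X => ip f (d y) * ip (e y) h) ∧
    ip f h = ∫ y : X, ip f (d y) * ip (e y) h

variable {A B : L2 →L[ℂ] L2}

lemma IsFrameOperator.ip_apply_left (hA : IsFrameOperator α ψ A) (f h : L2) :
    ip (A f) h = ip f (A h) := by
  rw [← ip_conj (A h) f, (hA f h).2, (hA h f).2, ← integral_conj]
  refine integral_congr_ae (.of_forall fun z => ?_)
  simp only [map_mul, ip_conj]
  ring

lemma IsFrameOperator.ip_inverse_left (hA : IsFrameOperator α ψ A) (hAB : A * B = 1)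
    (f h : L2) : ip (B f) h = ip f (B h) := by
  have hAB' (f : L2) : A (B f) = f := DFunLike.congr_fun hAB f
  have := hA.ip_apply_left (B f) (B h)
  rw [hAB', hAB'] at this
  exact this.symm

lemma IsFrameOperator.isDualPair_left (hA : IsFrameOperator α ψ A) (hAB : A * B = 1) :
    IsDualPair (fun z => B (atom α ψ z)) (atom α ψ) := fun f h => by
  have := hA (B f) h
  simp only [hA.ip_inverse_left hAB f, show A (B f) = f from DFunLike.congr_fun hAB f] at this
  exact this

lemma IsFrameOperator.isDualPair_right (hA : IsFrameOperator α ψ A) (hAB : A * B = 1) :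
    IsDualPair (atom α ψ) (fun z => B (atom α ψ z)) := fun f h => by
  have := hA f (B h)
  rw [hA.ip_apply_left, show A (B h) = h from DFunLike.congr_fun hAB h] at this
  simpa only [hA.ip_inverse_left hAB] using this

lemma IsFrameOperator.frameInv_eq (hA : IsFrameOperator α ψ A) (hAB : A * B = 1)
    (hBA : B * A = 1) : frameInv α ψ = B := by
  rw [frameInv, frameOp_eq hA]
  exact Ring.inverse_unit ⟨A, B, hAB, hBA⟩

lemma IsFrameOperator.dualAtom_eq (hA : IsFrameOperator α ψ A) (hAB : A * B = 1)
    (hBA : B * A = 1) : dualAtom α ψ = fun z => B (atom α ψ z) := by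
  ext1 z
  rw [dualAtom, hA.frameInv_eq hAB hBA]

theorem IsWindow.admissible (hα0 : 0 ≤ α) (hα1 : α < 1) (hr : 1 < r)
    (hr' : 1 + α / (1 - α) < 2 * r) (h : IsWindow r C ψ g) (hψ : ψ ≠ 0) :
    Admissible α ψ ∧ (∃ c, IsSymbol α c ∧ frameInv α ψ = fmul c) ∧
      IsDualPair (dualAtom α ψ) (atom α ψ) ∧ IsDualPair (atom α ψ) (dualAtom α ψ) := by
  obtain ⟨b, c, hc, hbc, hA⟩ := h.exists_isFrameOperator hα0 hα1 hr hr' hψ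
  have hbc' : fmul b * fmul c = 1 := by rw [fmul_mul, hbc, fmul_one]
  have hcb' : fmul c * fmul b = 1 := by rw [fmul_mul, mul_comm, hbc, fmul_one]
  refine ⟨⟨hψ, _, hA, ⟨fmul b, fmul c, hbc', hcb'⟩, rfl⟩, ⟨c, hc, hA.frameInv_eq hbc' hcb'⟩, ?_⟩
  rw [hA.dualAtom_eq hbc' hcb']
  exact ⟨hA.isDualPair_left hbc', hA.isDualPair_right hbc'⟩

/-- `e` is a family of molecules of some profile. -/
def IsMoleculeFamily (α t : ℝ) (e : X → L2) : Prop := ∃ C P, IsMolecule α t C e P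

lemma IsWindow.isMoleculeFamily (hα0 : 0 ≤ α) (hα1 : α < 1) (hr : 1 < r)
    (h : IsWindow r C φ g) {b : ℝ →ᵇ ℂ} (hb : IsSymbol α b) :
    IsMoleculeFamily α (r - α / (1 - α)) fun z => fmul b (atom α φ z) :=
  let ⟨_, h'⟩ := (h.isMolecule_atom hα0 hα1 hr).fmul hα0 hα1 hb
  ⟨_, _, h'⟩

end Admissible

section IntegralOperators

lemma exists_continuousLinearMap_comp_eq {𝕜 E L : Type*} [RCLike 𝕜] [AddCommGroup E] [Module 𝕜 E]
    [NormedAddCommGroup L] [NormedSpace 𝕜 L] (J : E →ₗ[𝕜] L) (f : E →ₗ[𝕜] 𝕜) {C : ℝ}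
    (h : ∀ u, ‖f u‖ ≤ C * ‖J u‖) : ∃ Φ : L →L[𝕜] 𝕜, ∀ u, Φ (J u) = f u := by
  obtain ⟨g, hg⟩ := LinearMap.exists_rightInverse_of_surjective J.rangeRestrict
    J.range_rangeRestrict
  have hJg (y : LinearMap.range J) : J (g y) = y :=
    congrArg Subtype.val (LinearMap.congr_fun hg y)
  obtain ⟨Φ, hΦ, -⟩ := exists_extension_norm_eq (LinearMap.range J)
    ((f ∘ₗ g).mkContinuous C fun y => (h (g y)).trans_eq (by rw [hJg]; rfl))
  refine ⟨Φ, fun u => ?_⟩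
  have hker : f (g (J.rangeRestrict u) - u) = 0 := by
    have hsub : J (g (J.rangeRestrict u) - u) = 0 := by
      rw [map_sub, hJg]
      exact sub_self (J u)
    simpa only [hsub, norm_zero, mul_zero, norm_le_zero_iff] using h (g (J.rangeRestrict u) - u)
  rw [map_sub, sub_eq_zero] at hker
  exact (hΦ (J.rangeRestrict u)).trans hker

variable {Y Z E : Type*} [MeasurableSpace Y] [MeasurableSpace Z] {μ : Measure Y} {ν : Measure Z}

lemma measurable_of_measurable_edist [PseudoEMetricSpace E] [SecondCountableTopology E]
    [MeasurableSpace E] [BorelSpace E] {f : Y → E} (h : ∀ c, Measurable fun y => edist (f y) c) :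
    Measurable f := by
  have hbasis : TopologicalSpace.IsTopologicalBasis
      {s : Set E | ∃ c ε, s = Metric.eball c ε} := by
    refine TopologicalSpace.isTopologicalBasis_of_isOpen_of_nhds ?_ fun a u ha hu => ?_
    · rintro _ ⟨c, ε, rfl⟩
      exact Metric.isOpen_eball
    · obtain ⟨ε, hε, hs⟩ := EMetric.isOpen_iff.1 hu a ha
      exact ⟨_, ⟨a, ε, rfl⟩, Metric.mem_eball_self hε, hs⟩
  rw [‹BorelSpace E›.measurable_eq, hbasis.borel_eq_generateFrom]
  refine measurable_generateFrom ?_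
  rintro _ ⟨c, ε, rfl⟩
  exact measurableSet_lt (h c) measurable_const

section ToLp

variable [NormedAddCommGroup E] [TopologicalSpace.SeparableSpace E] [SFinite ν] [IsSeparable ν]
  {K : Y → Z → E}

lemma stronglyMeasurable_toLp_one (hK : StronglyMeasurable (Function.uncurry K))
    (hm : ∀ y, MemLp (K y) 1 ν) : StronglyMeasurable fun y => (hm y).toLp (K y) := by
  let _ : MeasurableSpace (Lp E 1 ν) := borel _
  have : BorelSpace (Lp E 1 ν) := ⟨rfl⟩
  have : Fact ((1 : ℝ≥0∞) ≠ ∞) := ⟨ENNReal.one_ne_top⟩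
  refine Measurable.stronglyMeasurable (measurable_of_measurable_edist fun c => ?_)
  have hedist (y : Y) : edist ((hm y).toLp (K y)) c = ∫⁻ z, ‖K y z - c z‖ₑ ∂ν := by
    rw [Lp.edist_def, eLpNorm_one_eq_lintegral_enorm]
    refine lintegral_congr_ae ?_
    filter_upwards [(hm y).coeFn_toLp] with z hz
    rw [Pi.sub_apply, hz]
  simp only [hedist]
  exact (hK.sub
    ((Lp.stronglyMeasurable c).comp_measurable measurable_snd)).enorm.lintegral_prod_right

lemma integrable_toLp_one (hK : StronglyMeasurable (Function.uncurry K))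
    (hm : ∀ y, MemLp (K y) 1 ν) (hint : ∫⁻ y, ∫⁻ z, ‖K y z‖ₑ ∂ν ∂μ < ∞) :
    Integrable (fun y => (hm y).toLp (K y)) μ := by
  refine ⟨(stronglyMeasurable_toLp_one hK hm).aestronglyMeasurable, ?_⟩
  simpa only [HasFiniteIntegral, Lp.enorm_toLp, eLpNorm_one_eq_lintegral_enorm] using hint

theorem integral_toLp_one_ae [NormedSpace ℝ E] [CompleteSpace E] [SFinite μ]
    (hK : StronglyMeasurable (Function.uncurry K)) (hm : ∀ y, MemLp (K y) 1 ν)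
    (hint : ∫⁻ y, ∫⁻ z, ‖K y z‖ₑ ∂ν ∂μ < ∞) :
    ⇑(∫ y, (hm y).toLp (K y) ∂μ) =ᵐ[ν] fun z => ∫ y, K y z ∂μ := by
  have hprod : Integrable (Function.uncurry K) (μ.prod ν) := by
    refine ⟨hK.aestronglyMeasurable, ?_⟩
    rwa [HasFiniteIntegral, lintegral_prod _ hK.enorm.aemeasurable]
  refine Integrable.ae_eq_of_forall_setIntegral_eq _ _
    (memLp_one_iff_integrable.1 (Lp.memLp _)) hprod.integral_prod_right fun S _ _ => ?_
  have hrestrict (f : Lp E 1 ν) :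
      (L1.integralCLM (μ := ν.restrict S) ∘L LpToLpRestrictCLM Z E ℝ ν 1 S) f =
        ∫ z in S, f z ∂ν :=
    (L1.integral_eq _).symm.trans <| (L1.integral_eq_integral _).trans <|
      integral_congr_ae (LpToLpRestrictCLM_coeFn ℝ S f)
  rw [← hrestrict, ← ContinuousLinearMap.integral_comp_comm _ (integrable_toLp_one hK hm hint)]
  simp only [hrestrict]
  calc ∫ y, ∫ z in S, (hm y).toLp (K y) z ∂ν ∂μ = ∫ y, ∫ z in S, K y z ∂ν ∂μ :=
        integral_congr_ae (.of_forall fun y =>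
          integral_congr_ae (ae_restrict_of_ae (hm y).coeFn_toLp))
    _ = ∫ z in S, ∫ y, K y z ∂μ ∂ν :=
        integral_integral_swap <|
          hprod.mono_measure (Measure.prod_mono le_rfl Measure.restrict_le_self)

end ToLp

section Schur

variable {k : Y → ℝ≥0∞} {K : Y → Z → ℝ≥0∞} {F : Y → ℝ≥0∞} {M : ℝ≥0∞}

lemma lintegral_mul_rpow_le (hk : Measurable k) (hF : Measurable F) (hM : ∫⁻ y, k y ∂μ ≤ M)
    {q : ℝ} (hq : 1 ≤ q) :
    (∫⁻ y, k y * F y ∂μ) ^ q ≤ M ^ (q - 1) * ∫⁻ y, k y * F y ^ q ∂μ := by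
  have hq0 : 0 < q := by linarith
  have h := eLpNorm_le_eLpNorm_mul_rpow_measure_univ (μ := μ.withDensity k) (f := F)
    (p := 1) (q := ENNReal.ofReal q) (ENNReal.one_le_ofReal.2 hq) hF.aestronglyMeasurable
  rw [eLpNorm_one_eq_lintegral_enorm, eLpNorm_eq_lintegral_rpow_enorm_toReal
    (ENNReal.ofReal_pos.2 hq0).ne' ENNReal.ofReal_ne_top, ENNReal.toReal_ofReal hq0.le] at h
  simp only [enorm_eq_self, ENNReal.toReal_one] at h
  rw [lintegral_withDensity_eq_lintegral_mul _ hk hF,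
    lintegral_withDensity_eq_lintegral_mul _ hk (hF.pow_const q),
    withDensity_apply _ MeasurableSet.univ, setLIntegral_univ] at h
  have hpow := ENNReal.rpow_le_rpow h hq0.le
  rw [ENNReal.mul_rpow_of_nonneg _ _ hq0.le, ← ENNReal.rpow_mul, ← ENNReal.rpow_mul,
    one_div_mul_cancel hq0.ne', ENNReal.rpow_one,
    show (1 / 1 - 1 / q) * q = q - 1 by field_simp] at hpow
  exact hpow.trans ((mul_comm _ _).trans_le
    (mul_le_mul_left (ENNReal.rpow_le_rpow hM (by linarith)) _))

lemma eLpNorm_top_lintegral_le (hK : Measurable (Function.uncurry K))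
    (hleft : ∀ z, ∫⁻ y, K y z ∂μ ≤ M) :
    eLpNorm (fun z => ∫⁻ y, K y z * F y ∂μ) ∞ ν ≤ M * eLpNorm F ∞ μ := by
  simp only [eLpNorm_exponent_top]
  refine eLpNormEssSup_le_of_ae_enorm_bound (.of_forall fun z => ?_)
  rw [enorm_eq_self]
  calc ∫⁻ y, K y z * F y ∂μ ≤ ∫⁻ y, K y z * eLpNormEssSup F μ ∂μ := by
        refine lintegral_mono_ae ?_
        filter_upwards [enorm_ae_le_eLpNormEssSup F μ] with y hy
        exact mul_le_mul_right hy _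
    _ = (∫⁻ y, K y z ∂μ) * eLpNormEssSup F μ := lintegral_mul_const _ hK.of_uncurry_right
    _ ≤ M * eLpNormEssSup F μ := mul_le_mul_left (hleft z) _

lemma lintegral_rpow_lintegral_le [SFinite μ] [SFinite ν] (hK : Measurable (Function.uncurry K))
    (hM : M ≠ ∞) (hleft : ∀ z, ∫⁻ y, K y z ∂μ ≤ M) (hright : ∀ y, ∫⁻ z, K y z ∂ν ≤ M)
    (hF : Measurable F) {q : ℝ} (hq : 1 ≤ q) :
    ∫⁻ z, (∫⁻ y, K y z * F y ∂μ) ^ q ∂ν ≤ M ^ q * ∫⁻ y, F y ^ q ∂μ := by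
  have hKF : AEMeasurable (Function.uncurry fun z y => K y z * F y ^ q) (ν.prod μ) :=
    ((hK.comp measurable_swap).mul ((hF.pow_const q).comp measurable_snd)).aemeasurable
  calc ∫⁻ z, (∫⁻ y, K y z * F y ∂μ) ^ q ∂ν
      ≤ ∫⁻ z, M ^ (q - 1) * ∫⁻ y, K y z * F y ^ q ∂μ ∂ν :=
        lintegral_mono fun z => lintegral_mul_rpow_le hK.of_uncurry_right hF (hleft z) hq
    _ = M ^ (q - 1) * ∫⁻ y, (∫⁻ z, K y z ∂ν) * F y ^ q ∂μ := by
        rw [lintegral_const_mul' _ _ (ENNReal.rpow_ne_top_of_nonneg (by linarith) hM),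
          lintegral_lintegral_swap hKF]
        simp only [lintegral_mul_const _ hK.of_uncurry_left]
    _ ≤ M ^ (q - 1) * ∫⁻ y, M * F y ^ q ∂μ := by
        gcongr with y
        exact hright y
    _ = M ^ q * ∫⁻ y, F y ^ q ∂μ := by
        rw [lintegral_const_mul' _ _ hM, ← mul_assoc]
        congr 1
        nth_rw 2 [← ENNReal.rpow_one M]
        rw [← ENNReal.rpow_add_of_nonneg _ _ (by linarith) zero_le_one, sub_add_cancel]

theorem eLpNorm_lintegral_le [SFinite μ] [SFinite ν] (hK : Measurable (Function.uncurry K))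
    (hM : M ≠ ∞) (hleft : ∀ z, ∫⁻ y, K y z ∂μ ≤ M) (hright : ∀ y, ∫⁻ z, K y z ∂ν ≤ M)
    (hF : Measurable F) {p : ℝ≥0∞} (hp : 1 ≤ p) :
    eLpNorm (fun z => ∫⁻ y, K y z * F y ∂μ) p ν ≤ M * eLpNorm F p μ := by
  obtain rfl | hp_top := eq_or_ne p ∞
  · exact eLpNorm_top_lintegral_le hK hleft
  have hp0 : p ≠ 0 := (zero_lt_one.trans_le hp).ne'
  have hq : 1 ≤ p.toReal := by
    rw [← ENNReal.toReal_one]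
    exact ENNReal.toReal_mono hp_top hp
  have hq0 : 0 < p.toReal := by linarith
  rw [eLpNorm_eq_lintegral_rpow_enorm_toReal hp0 hp_top,
    eLpNorm_eq_lintegral_rpow_enorm_toReal hp0 hp_top]
  simp only [enorm_eq_self]
  refine (ENNReal.rpow_le_rpow (lintegral_rpow_lintegral_le hK hM hleft hright hF hq)
    (by positivity)).trans_eq ?_
  rw [ENNReal.mul_rpow_of_nonneg _ _ (by positivity), ← ENNReal.rpow_mul,
    mul_one_div_cancel hq0.ne', ENNReal.rpow_one]

end Schur

end IntegralOperators

section Coorbit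

variable {v : X → ℝ} {M : ℝ≥0} {a b d e e₀ : X → L2} {Φ : X → ℂ} {p : ℝ≥0∞}

/-- The hypothesis of Schur's test for the cross kernel `⟨a(z), b(z')⟩` of two families, weighted by
the ratio of the weight `v` at the two points. -/
structure KernelBound (v : X → ℝ) (M : ℝ≥0) (a b : X → L2) : Prop where
  stronglyMeasurable : StronglyMeasurable fun p : X × X => ip (a p.1) (b p.2)
  left : ∀ z', ∫⁻ z, ‖ip (a z) (b z')‖ₑ * ENNReal.ofReal (ratioWeight v z z') ≤ M
  right : ∀ z, ∫⁻ z', ‖ip (a z) (b z')‖ₑ * ENNReal.ofReal (ratioWeight v z z') ≤ M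

lemma enorm_ip_comm (f g : L2) : ‖ip f g‖ₑ = ‖ip g f‖ₑ := by
  rw [← ip_conj f g, RCLike.enorm_conj]

lemma IsMoleculeFamily.exists_kernelBound {α s t : ℝ} (hα0 : 0 ≤ α) (hα1 : α < 1)
    (ht : 1 + (|s| + α) / (1 - α) < t) (ha : IsMoleculeFamily α t a)
    (hb : IsMoleculeFamily α t b) : ∃ M, KernelBound (polyWeight s) M a b := by
  obtain ⟨C, P, ha⟩ := ha
  obtain ⟨C', P', hb⟩ := hb
  refine ⟨(2 * kernelConst α t * (C * C')).toNNReal *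
    (decayInt (t - (|s| + α) / (1 - α))).toNNReal, ha.stronglyMeasurable_kernel hb,
    ha.lintegral_kernel_le hα0 hα1 ht hb, fun z => ?_⟩
  simp only [enorm_ip_comm (a z), ratioWeight_comm _ z, mul_comm C C']
  exact hb.lintegral_kernel_le hα0 hα1 ht ha z

lemma ofReal_weight_le (hv : ∀ z, 0 < v z) (y z : X) :
    ENNReal.ofReal (v z) ≤ ENNReal.ofReal (ratioWeight v y z) * ENNReal.ofReal (v y) := by
  rw [← ENNReal.ofReal_mul' (hv y).le]
  exact ENNReal.ofReal_le_ofReal ((div_le_iff₀ (hv y)).1 (le_max_right _ _))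

lemma enorm_mul_weight (hv : ∀ z, 0 < v z) (c : ℂ) (z : X) :
    ‖c * (v z : ℂ)‖ₑ = ‖c‖ₑ * ENNReal.ofReal (v z) := by
  rw [enorm_mul, ← ofReal_norm (v z : ℂ), Complex.norm_real, Real.norm_of_nonneg (hv z).le]

lemma measurable_ratioWeight (hvm : Measurable v) :
    Measurable fun p : X × X => ratioWeight v p.1 p.2 :=
  have h₁ := hvm.comp (measurable_fst (α := X) (β := X))
  have h₂ := hvm.comp (measurable_snd (α := X) (β := X))
  (h₁.div h₂).max (h₂.div h₁)

lemma stronglyMeasurable_mul_weight (hvm : Measurable v) (hΦ : StronglyMeasurable Φ) :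
    StronglyMeasurable fun z => Φ z * (v z : ℂ) :=
  hΦ.mul (Complex.measurable_ofReal.comp hvm).stronglyMeasurable

namespace KernelBound

lemma enorm_integral_mul_weight_le (hv : ∀ z, 0 < v z) (z : X) :
    ‖(∫ y, Φ y * ip (a y) (b z)) * (v z : ℂ)‖ₑ ≤
      ∫⁻ y, ‖ip (a y) (b z)‖ₑ * ENNReal.ofReal (ratioWeight v y z) * ‖Φ y * (v y : ℂ)‖ₑ := by
  rw [enorm_mul_weight hv]
  calc ‖∫ y, Φ y * ip (a y) (b z)‖ₑ * ENNReal.ofReal (v z)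
      ≤ (∫⁻ y, ‖Φ y * ip (a y) (b z)‖ₑ) * ENNReal.ofReal (v z) := by
        gcongr
        exact enorm_integral_le_lintegral_enorm _
    _ = ∫⁻ y, ‖Φ y * ip (a y) (b z)‖ₑ * ENNReal.ofReal (v z) :=
        (lintegral_mul_const' _ _ ENNReal.ofReal_ne_top).symm
    _ ≤ _ := lintegral_mono fun y => ?_
  calc ‖Φ y * ip (a y) (b z)‖ₑ * ENNReal.ofReal (v z)
      ≤ ‖Φ y * ip (a y) (b z)‖ₑ *
          (ENNReal.ofReal (ratioWeight v y z) * ENNReal.ofReal (v y)) := by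
        gcongr
        exact ofReal_weight_le hv y z
    _ = _ := by
        rw [enorm_mul_weight hv, enorm_mul]
        ring

theorem wNorm_integral_le (hvm : Measurable v) (hv : ∀ z, 0 < v z) (hab : KernelBound v M a b)
    (hΦ : StronglyMeasurable Φ) (hp : 1 ≤ p) :
    wNorm p v (fun z => ∫ y, Φ y * ip (a y) (b z)) ≤ M * wNorm p v Φ := by
  have hK : Measurable (Function.uncurry fun y z => ‖ip (a y) (b z)‖ₑ *
      ENNReal.ofReal (ratioWeight v y z)) :=
    hab.stronglyMeasurable.enorm.mul (measurable_ratioWeight hvm).ennreal_ofReal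
  have hschur := eLpNorm_lintegral_le (ν := volume) hK ENNReal.coe_ne_top hab.left hab.right
    (stronglyMeasurable_mul_weight hvm hΦ).enorm hp
  rw [eLpNorm_enorm] at hschur
  exact (eLpNorm_mono_enorm fun z => enorm_integral_mul_weight_le hv z).trans hschur

lemma memLpv_integral (hvm : Measurable v) (hv : ∀ z, 0 < v z) (hab : KernelBound v M a b)
    (hΦ : StronglyMeasurable Φ) (hp : 1 ≤ p) (h : MemLpv p v Φ) :
    MemLpv p v (fun z => ∫ y, Φ y * ip (a y) (b z)) := by
  have hmeas : StronglyMeasurable fun z => ∫ y, Φ y * ip (a y) (b z) :=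
    ((hΦ.comp_measurable measurable_fst).mul hab.stronglyMeasurable).integral_prod_left'
  exact ⟨(stronglyMeasurable_mul_weight hvm hmeas).aestronglyMeasurable,
    (hab.wNorm_integral_le hvm hv hΦ hp).trans_lt (ENNReal.mul_lt_top ENNReal.coe_lt_top h.2)⟩

lemma wNorm_one_le (hv : ∀ z, 0 < v z) (hab : KernelBound v M a b) (y : X) :
    wNorm 1 v (fun z => ip (a y) (b z)) ≤ M * ENNReal.ofReal (v y) := by
  rw [wNorm, eLpNorm_one_eq_lintegral_enorm]
  calc ∫⁻ z, ‖ip (a y) (b z) * (v z : ℂ)‖ₑ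
      ≤ ∫⁻ z, ‖ip (a y) (b z)‖ₑ * ENNReal.ofReal (ratioWeight v y z) * ENNReal.ofReal (v y) := by
        refine lintegral_mono fun z => ?_
        rw [enorm_mul_weight hv, mul_assoc]
        gcongr
        exact ofReal_weight_le hv y z
    _ ≤ M * ENNReal.ofReal (v y) := by
        rw [lintegral_mul_const' _ _ ENNReal.ofReal_ne_top]
        gcongr
        exact hab.right y

lemma mem_reservoir (hvm : Measurable v) (hv : ∀ z, 0 < v z) (hab : KernelBound v M a b) (y : X) :
    a y ∈ reservoir v b :=
  ⟨(stronglyMeasurable_mul_weight hvm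
      (hab.stronglyMeasurable.comp_measurable measurable_prodMk_left)).aestronglyMeasurable,
    (hab.wNorm_one_le hv y).trans_lt (ENNReal.mul_lt_top ENNReal.coe_lt_top ENNReal.ofReal_lt_top)⟩

end KernelBound

lemma IsDualPair.wNorm_le (hvm : Measurable v) (hv : ∀ z, 0 < v z) (hde : IsDualPair d e)
    (hk : KernelBound v M e b) {f : L2} (hf : StronglyMeasurable fun z => ip f (d z)) :
    wNorm 1 v (fun z => ip f (b z)) ≤ M * wNorm 1 v (fun z => ip f (d z)) := by
  simpa only [← (hde f _).2] using hk.wNorm_integral_le hvm hv hf le_rfl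

lemma IsDualPair.mem_reservoir (hvm : Measurable v) (hv : ∀ z, 0 < v z) (hde : IsDualPair d e)
    (hk : KernelBound v M e b) {f : L2} (hf : StronglyMeasurable fun z => ip f (d z))
    (hfd : f ∈ reservoir v d) : f ∈ reservoir v b := by
  have h := hk.memLpv_integral hvm hv hf le_rfl hfd
  simp only [← (hde f _).2] at h
  exact h

lemma memLp_of_mem_reservoir {u : L2} (hu : u ∈ reservoir v e) :
    MemLp (fun z => ip u (e z) * (v z : ℂ)) 1 volume := hu

/-- The isometry `f ↦ ⟨f, e(·)⟩ v` of the reservoir of `e` into `L¹`. -/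
noncomputable def reservoirToL1 (v : X → ℝ) (e : X → L2) :
    reservoir v e →ₗ[ℂ] Lp ℂ 1 (volume : Measure X) where
  toFun u := (memLp_of_mem_reservoir u.2).toLp _
  map_add' f g := by
    rw [← MemLp.toLp_add]
    refine MemLp.toLp_congr _ _ (.of_forall fun z => ?_)
    simp only [Pi.add_apply, ip, Submodule.coe_add, inner_add_right]
    ring
  map_smul' c f := by
    rw [RingHom.id_apply, ← MemLp.toLp_const_smul]
    refine MemLp.toLp_congr _ _ (.of_forall fun z => ?_)
    simp only [Pi.smul_apply, ip, Submodule.coe_smul, inner_smul_right, smul_eq_mul]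
    ring

lemma norm_reservoirToL1 (v : X → ℝ) (e : X → L2) (u : reservoir v e) :
    ‖reservoirToL1 v e u‖ = (wNorm 1 v fun z => ip (u : L2) (e z)).toReal :=
  Lp.norm_toLp _ u.2

namespace KernelBound

lemma stronglyMeasurable_mul_weight (hvm : Measurable v) (hk : KernelBound v M e e₀) :
    StronglyMeasurable (Function.uncurry fun y z => ip (e y) (e₀ z) * (v z : ℂ)) :=
  hk.stronglyMeasurable.mul
    ((Complex.measurable_ofReal.comp hvm).comp measurable_snd).stronglyMeasurable

lemma lintegral_lintegral_enorm_lt_top (hv : ∀ z, 0 < v z) (hk : KernelBound v M e e₀)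
    (hΦ : MemLpv 1 v Φ) : ∫⁻ y, ∫⁻ z, ‖Φ y • (ip (e y) (e₀ z) * (v z : ℂ))‖ₑ < ∞ := by
  have hnorm : ∫⁻ y, ‖Φ y * (v y : ℂ)‖ₑ < ∞ := by
    rw [← eLpNorm_one_eq_lintegral_enorm]
    exact hΦ.2
  calc ∫⁻ y, ∫⁻ z, ‖Φ y • (ip (e y) (e₀ z) * (v z : ℂ))‖ₑ
      = ∫⁻ y, ‖Φ y‖ₑ * wNorm 1 v (fun z => ip (e y) (e₀ z)) := by
        simp only [enorm_smul, lintegral_const_mul' _ _ enorm_ne_top, wNorm,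
          eLpNorm_one_eq_lintegral_enorm]
    _ ≤ ∫⁻ y, M * ‖Φ y * (v y : ℂ)‖ₑ := by
        refine lintegral_mono fun y => ?_
        rw [enorm_mul_weight hv, mul_left_comm]
        gcongr
        exact hk.wNorm_one_le hv y
    _ < ∞ := by
        rw [lintegral_const_mul' _ _ ENNReal.coe_ne_top]
        exact ENNReal.mul_lt_top ENNReal.coe_lt_top hnorm

end KernelBound

/-- The weak expansion `u = ∫ ⟨u, d(y)⟩ e(y) dy` converges in the norm of the reservoir of `e₀`. -/
theorem IsDualPair.integral_smul_reservoirToL1 (hvm : Measurable v) (hv : ∀ z, 0 < v z)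
    (hde : IsDualPair d e) (hk : KernelBound v M e e₀) (u : reservoir v e₀)
    (hu : MemLpv 1 v fun z => ip (u : L2) (d z))
    (hum : StronglyMeasurable fun z => ip (u : L2) (d z)) :
    Integrable (fun y => ip (u : L2) (d y) •
      reservoirToL1 v e₀ ⟨e y, hk.mem_reservoir hvm hv y⟩) ∧
    ∫ y, ip (u : L2) (d y) • reservoirToL1 v e₀ ⟨e y, hk.mem_reservoir hvm hv y⟩ =
      reservoirToL1 v e₀ u := by
  have hK : StronglyMeasurable (Function.uncurry fun y z =>
      ip (u : L2) (d y) • (ip (e y) (e₀ z) * (v z : ℂ))) :=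
    (hum.comp_measurable measurable_fst).smul (hk.stronglyMeasurable_mul_weight hvm)
  have hm (y : X) : MemLp (fun z => ip (u : L2) (d y) • (ip (e y) (e₀ z) * (v z : ℂ))) 1 volume :=
    (memLp_of_mem_reservoir (hk.mem_reservoir hvm hv y)).const_smul (ip (u : L2) (d y))
  have hfin := hk.lintegral_lintegral_enorm_lt_top hv hu
  refine ⟨integrable_toLp_one hK hm hfin, Lp.ext ?_⟩
  filter_upwards [integral_toLp_one_ae hK hm hfin, MemLp.coeFn_toLp u.2] with z hz huz
  refine hz.trans (Eq.trans ?_ huz.symm)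
  rw [(hde u (e₀ z)).2, ← integral_mul_const]
  simp only [smul_eq_mul, mul_assoc]

lemma AntiFunctional.pair_of_mem (F : AntiFunctional) {u : L2} (h : u ∈ F.domain) :
    F.pair u = F.toFun ⟨u, h⟩ := dif_pos h

lemma exists_pair_eq_conj {F : AntiFunctional} (hF : F ∈ antiDual v e₀) :
    ∃ Φ : Lp ℂ 1 (volume : Measure X) →L[ℂ] ℂ, ∀ u (hu : u ∈ reservoir v e₀),
      F.pair u = starRingEnd ℂ (Φ (reservoirToL1 v e₀ ⟨u, hu⟩)) := by
  obtain ⟨D, T⟩ := F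
  obtain ⟨rfl, C, hC⟩ := hF
  let f : reservoir v e₀ →ₗ[ℂ] ℂ :=
    { toFun := fun u => starRingEnd ℂ (T u)
      map_add' := fun u w => by rw [map_add, map_add]
      map_smul' := fun c u => by
        rw [LinearMap.map_smulₛₗ, smul_eq_mul, map_mul, RCLike.conj_conj, RingHom.id_apply,
          smul_eq_mul] }
  obtain ⟨Φ, hΦ⟩ := exists_continuousLinearMap_comp_eq (reservoirToL1 v e₀) f (C := C) fun u => by
    rw [norm_reservoirToL1]
    exact (RCLike.norm_conj _).trans_le (hC u)
  refine ⟨Φ, fun u hu => ?_⟩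
  rw [AntiFunctional.pair_of_mem _ hu, hΦ]
  exact (RCLike.conj_conj _).symm

lemma stronglyMeasurable_pair (hvm : Measurable v) (hv : ∀ z, 0 < v z)
    (hk : KernelBound v M e e₀) {F : AntiFunctional} (hF : F ∈ antiDual v e₀) :
    StronglyMeasurable fun y => F.pair (e y) := by
  obtain ⟨Φ, hΦ⟩ := exists_pair_eq_conj hF
  have hmem := hk.mem_reservoir hvm hv
  simp only [fun y => hΦ _ (hmem y)]
  exact (Complex.continuous_conj.comp Φ.continuous).comp_stronglyMeasurable
    (stronglyMeasurable_toLp_one (hk.stronglyMeasurable_mul_weight hvm) hmem)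

theorem IsDualPair.pair_eq_integral (hvm : Measurable v) (hv : ∀ z, 0 < v z)
    (hde : IsDualPair d e) (hk : KernelBound v M e e₀)
    {F : AntiFunctional} (hF : F ∈ antiDual v e₀) {u : L2} (hu : u ∈ reservoir v e₀)
    (hud : u ∈ reservoir v d) (hum : StronglyMeasurable fun z => ip u (d z)) :
    F.pair u = ∫ y, F.pair (e y) * ip (d y) u := by
  obtain ⟨Φ, hΦ⟩ := exists_pair_eq_conj hF
  obtain ⟨hint, heq⟩ := hde.integral_smul_reservoirToL1 hvm hv hk ⟨u, hu⟩ hud hum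
  rw [hΦ u hu, ← heq, ← ContinuousLinearMap.integral_comp_comm _ hint, ← integral_conj]
  refine integral_congr_ae (.of_forall fun y => ?_)
  simp only [map_smul, smul_eq_mul, map_mul, ip_conj]
  rw [hΦ _ (hk.mem_reservoir hvm hv y), mul_comm]

end Coorbit

section MoleculeFrame

variable {α s t : ℝ} {e e' e₀ e₀' : X → L2} {p : ℝ≥0∞}

/-- A family of molecules with a dual family of molecules. -/
def IsMoleculeFrame (α t : ℝ) (e : X → L2) : Prop :=
  IsMoleculeFamily α t e ∧ ∃ d, IsMoleculeFamily α t d ∧ IsDualPair d e ∧ IsDualPair e d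

lemma IsMoleculeFamily.stronglyMeasurable_ip (he : IsMoleculeFamily α t e) (f : L2) :
    StronglyMeasurable fun z => ip f (e z) :=
  let ⟨_, _, h⟩ := he
  h.stronglyMeasurable_ip f

lemma IsMoleculeFamily.mem_reservoir (hα0 : 0 ≤ α) (hα1 : α < 1)
    (ht : 1 + (|s| + α) / (1 - α) < t) (he : IsMoleculeFamily α t e)
    (he' : IsMoleculeFamily α t e') (z : X) : e z ∈ reservoir (polyWeight s) e' :=
  let ⟨_, hM⟩ := he.exists_kernelBound hα0 hα1 ht he'
  hM.mem_reservoir (continuous_polyWeight s).measurable (polyWeight_pos s) z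

namespace IsMoleculeFrame

lemma exists_wNorm_le (hα0 : 0 ≤ α) (hα1 : α < 1) (ht : 1 + (|s| + α) / (1 - α) < t)
    (he : IsMoleculeFrame α t e) (he' : IsMoleculeFamily α t e') : ∃ M : ℝ≥0, ∀ f,
      wNorm 1 (polyWeight s) (fun z => ip f (e' z)) ≤
        M * wNorm 1 (polyWeight s) (fun z => ip f (e z)) := by
  obtain ⟨hm, d, hd, -, hed⟩ := he
  obtain ⟨M, hM⟩ := hd.exists_kernelBound hα0 hα1 ht he'
  exact ⟨M, fun f => hed.wNorm_le (continuous_polyWeight s).measurable (polyWeight_pos s) hM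
    (hm.stronglyMeasurable_ip f)⟩

lemma reservoir_le (hα0 : 0 ≤ α) (hα1 : α < 1) (ht : 1 + (|s| + α) / (1 - α) < t)
    (he : IsMoleculeFrame α t e) (he' : IsMoleculeFamily α t e') :
    reservoir (polyWeight s) e ≤ reservoir (polyWeight s) e' := fun f hf => by
  obtain ⟨hm, d, hd, -, hed⟩ := he
  obtain ⟨M, hM⟩ := hd.exists_kernelBound hα0 hα1 ht he'
  exact hed.mem_reservoir (continuous_polyWeight s).measurable (polyWeight_pos s) hM
    (hm.stronglyMeasurable_ip f) hf

lemma antiDual_subset (hα0 : 0 ≤ α) (hα1 : α < 1) (ht : 1 + (|s| + α) / (1 - α) < t)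
    (he : IsMoleculeFrame α t e) (he' : IsMoleculeFrame α t e') :
    antiDual (polyWeight s) e ⊆ antiDual (polyWeight s) e' := by
  rintro F ⟨hD, C, hC⟩
  have hD' := hD.trans <| le_antisymm (he.reservoir_le hα0 hα1 ht he'.1)
    (he'.reservoir_le hα0 hα1 ht he.1)
  obtain ⟨M, hM⟩ := he'.exists_wNorm_le hα0 hα1 ht he.1
  refine ⟨hD', |C| * M, fun u => (hC u).trans ?_⟩
  have hu : (u : L2) ∈ reservoir (polyWeight s) e' := hD' ▸ u.2
  have hnorm := ENNReal.toReal_mono (ENNReal.mul_ne_top ENNReal.coe_ne_top hu.2.ne) (hM u)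
  rw [ENNReal.toReal_mul, ENNReal.coe_toReal] at hnorm
  rw [mul_assoc]
  exact mul_le_mul (le_abs_self C) hnorm ENNReal.toReal_nonneg (abs_nonneg C)

lemma antiDual_eq (hα0 : 0 ≤ α) (hα1 : α < 1) (ht : 1 + (|s| + α) / (1 - α) < t)
    (he : IsMoleculeFrame α t e) (he' : IsMoleculeFrame α t e') :
    antiDual (polyWeight s) e = antiDual (polyWeight s) e' :=
  (he.antiDual_subset hα0 hα1 ht he').antisymm (he'.antiDual_subset hα0 hα1 ht he)

lemma exists_pair_eq_integral (hα0 : 0 ≤ α) (hα1 : α < 1) (ht : 1 + (|s| + α) / (1 - α) < t)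
    (he₀ : IsMoleculeFrame α t e₀) (he : IsMoleculeFrame α t e) (he' : IsMoleculeFamily α t e') :
    ∃ d, ∃ M : ℝ≥0, KernelBound (polyWeight s) M d e' ∧
      ∀ F ∈ antiDual (polyWeight s) e₀, StronglyMeasurable (fun y => F.pair (e y)) ∧
        ∀ z, F.pair (e' z) = ∫ y, F.pair (e y) * ip (d y) (e' z) := by
  obtain ⟨hm, d, hd, hde, -⟩ := he
  have hvm := (continuous_polyWeight s).measurable
  obtain ⟨M, hM⟩ := hd.exists_kernelBound hα0 hα1 ht he'
  obtain ⟨M₀, hM₀⟩ := hm.exists_kernelBound hα0 hα1 ht he₀.1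
  exact ⟨d, M, hM, fun F hF => ⟨stronglyMeasurable_pair hvm (polyWeight_pos s) hM₀ hF, fun z =>
    hde.pair_eq_integral hvm (polyWeight_pos s) hM₀ hF (he'.mem_reservoir hα0 hα1 ht he₀.1 z)
      (he'.mem_reservoir hα0 hα1 ht hd z) (hd.stronglyMeasurable_ip _)⟩⟩

lemma exists_wNorm_pair_le (hα0 : 0 ≤ α) (hα1 : α < 1) (ht : 1 + (|s| + α) / (1 - α) < t)
    (he₀ : IsMoleculeFrame α t e₀) (he : IsMoleculeFrame α t e) (he' : IsMoleculeFamily α t e')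
    (hp : 1 ≤ p) : ∃ M : ℝ≥0, ∀ F ∈ antiDual (polyWeight s) e₀,
      wNorm p (polyWeight s) (fun z => F.pair (e' z)) ≤
        M * wNorm p (polyWeight s) (fun z => F.pair (e z)) ∧
      (MemLpv p (polyWeight s) (fun z => F.pair (e z)) →
        MemLpv p (polyWeight s) (fun z => F.pair (e' z))) := by
  obtain ⟨d, M, hM, hF⟩ := he₀.exists_pair_eq_integral hα0 hα1 ht he he'
  have hvm := (continuous_polyWeight s).measurable
  refine ⟨M, fun F hF₀ => ?_⟩
  obtain ⟨hmeas, hrep⟩ := hF F hF₀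
  simp only [hrep]
  exact ⟨hM.wNorm_integral_le hvm (polyWeight_pos s) hmeas hp,
    hM.memLpv_integral hvm (polyWeight_pos s) hmeas hp⟩

end IsMoleculeFrame

/-- The coorbit space of all functionals on the reservoir of `e₀` whose voice transform with respect
to `e` is in `L^p_v`. Thus `H_{p,v}` has `e₀ = atom α ψ`, `e = dualAtom α ψ`, and `K_{p,v}` has the
two families exchanged. -/
def coorbit (v : X → ℝ) (p : ℝ≥0∞) (e₀ e : X → L2) : Set AntiFunctional :=
  {F | F ∈ antiDual v e₀ ∧ MemLpv p v fun z => F.pair (e z)}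

theorem IsMoleculeFrame.coorbit_eq (hα0 : 0 ≤ α) (hα1 : α < 1)
    (ht : 1 + (|s| + α) / (1 - α) < t) (he₀ : IsMoleculeFrame α t e₀)
    (he₀' : IsMoleculeFrame α t e₀') (he : IsMoleculeFrame α t e) (he' : IsMoleculeFrame α t e')
    (hp : 1 ≤ p) :
    coorbit (polyWeight s) p e₀ e = coorbit (polyWeight s) p e₀' e' ∧
    EquivNormsOn (coorbit (polyWeight s) p e₀ e)
      (fun F => wNorm p (polyWeight s) fun z => F.pair (e z))
      (fun F => wNorm p (polyWeight s) fun z => F.pair (e' z)) := by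
  obtain ⟨M, hM⟩ := he₀.exists_wNorm_pair_le hα0 hα1 ht he he'.1 hp
  obtain ⟨M', hM'⟩ := he₀.exists_wNorm_pair_le hα0 hα1 ht he' he.1 hp
  refine ⟨?_, max M M', fun F hF => ⟨?_, ?_⟩⟩
  · rw [coorbit, coorbit, ← he₀.antiDual_eq hα0 hα1 ht he₀']
    ext F
    exact ⟨fun h => ⟨h.1, (hM F h.1).2 h.2⟩, fun h => ⟨h.1, (hM' F h.1).2 h.2⟩⟩
  · refine (hM' F hF.1).1.trans ?_
    gcongr
    exact le_max_right _ _
  · refine (hM F hF.1).1.trans ?_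
    gcongr
    exact le_max_left _ _

variable {r C : ℝ} {ψ : L2} {g : ℝ → ℂ}

lemma IsWindow.isMoleculeFamily_atom (hα0 : 0 ≤ α) (hα1 : α < 1) (hr : 1 < r)
    (h : IsWindow r C ψ g) : IsMoleculeFamily α (r - α / (1 - α)) (atom α ψ) := by
  simpa only [fmul_one, one_apply_eq_self] using
    h.isMoleculeFamily hα0 hα1 hr isSymbol_one

lemma IsWindow.isMoleculeFrame (hα0 : 0 ≤ α) (hα1 : α < 1) (hr : 1 < r)
    (hr' : 1 + α / (1 - α) < 2 * r) (h : IsWindow r C ψ g) (hψ : ψ ≠ 0) :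
    IsMoleculeFrame α (r - α / (1 - α)) (atom α ψ) ∧
      IsMoleculeFrame α (r - α / (1 - α)) (dualAtom α ψ) := by
  obtain ⟨-, ⟨c, hc, hinv⟩, hdual, hdual'⟩ := h.admissible hα0 hα1 hr hr' hψ
  have hatom := h.isMoleculeFamily_atom hα0 hα1 hr
  have hdualAtom : IsMoleculeFamily α (r - α / (1 - α)) (dualAtom α ψ) := by
    have := h.isMoleculeFamily hα0 hα1 hr hc
    rwa [← hinv] at this
  exact ⟨⟨hatom, _, hdualAtom, hdual, hdual'⟩, ⟨hdualAtom, _, hatom, hdual', hdual⟩⟩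

lemma molecule_order (hα0 : 0 ≤ α) (hα1 : α < 1) (hr : 1 + (|s| + 2 * α) / (1 - α) < r) :
    1 < r ∧ 1 + α / (1 - α) < 2 * r ∧ 1 + (|s| + α) / (1 - α) < r - α / (1 - α) := by
  have ha : 0 < 1 - α := by linarith
  have hs := div_nonneg (abs_nonneg s) ha.le
  have hα := div_nonneg hα0 ha.le
  rw [add_div, mul_div_assoc] at hr
  rw [add_div]
  refine ⟨?_, ?_, ?_⟩ <;> linarith

lemma exponent_lt (hα0 : 0 ≤ α) (hα1 : α < 1) (hs : 0 ≤ s)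
    (hr : (2 + 2 * s + 7 * α - 4 * α ^ 2) / (2 * (1 - α) ^ 2) < r) :
    1 + (|s| + 2 * α) / (1 - α) < r := by
  have ha : 0 < 1 - α := by linarith
  refine lt_of_le_of_lt ?_ hr
  rw [abs_of_nonneg hs, le_div_iff₀ (by positivity)]
  calc (1 + (s + 2 * α) / (1 - α)) * (2 * (1 - α) ^ 2)
      = 2 * (1 - α) * (1 - α + (s + 2 * α)) := by field_simp
    _ ≤ 2 + 2 * s + 7 * α - 4 * α ^ 2 := by nlinarith [mul_nonneg hα0 hs, mul_nonneg hα0 ha.le]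

end MoleculeFrame

end AlphaMod

theorem theorem5p1_general {α : ℝ} (hα0 : 0 ≤ α) (hα1 : α < 1) {s r : ℝ}
    (hr : 1 + (|s| + 2 * α) / (1 - α) < r) {ψ φ : L2} {C C' : ℝ} {g h : ℝ → ℂ} (hψ0 : ψ ≠ 0)
    (hψ : IsWindow r C ψ g) (hφ : IsWindow r C' φ h) :
    Admissible α ψ ∧
    (∀ κ : ℕ, (⨆ z' : X, ∫⁻ z : X,
      ‖kernelK α κ ψ φ z z'‖ₑ * ENNReal.ofReal (ratioWeight (polyWeight s) z z')) < ∞) ∧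
    FundamentalCondition α ψ (polyWeight s) ∧
    (∀ z : X, atom α ψ z ∈ spaceH1 α ψ (polyWeight s) ∧
      dualAtom α ψ z ∈ spaceK1 α ψ (polyWeight s)) ∧
    (∀ p : ℝ≥0∞, 1 ≤ p →
      spaceH α ψ p (polyWeight s) = spaceK α ψ p (polyWeight s) ∧
      EquivNormsOn (spaceH α ψ p (polyWeight s))
        (fun F => wNorm p (polyWeight s) (extW α ψ F))
        (fun F => wNorm p (polyWeight s) (extV α ψ F))) ∧
    (φ ≠ 0 → ∀ p : ℝ≥0∞, 1 ≤ p →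
      spaceH α ψ p (polyWeight s) = spaceH α φ p (polyWeight s) ∧
      EquivNormsOn (spaceH α ψ p (polyWeight s))
        (fun F => wNorm p (polyWeight s) (extW α ψ F))
        (fun F => wNorm p (polyWeight s) (extW α φ F))) := by
  obtain ⟨hr1, hr2, ht⟩ := molecule_order hα0 hα1 hr
  obtain ⟨hadm, ⟨c, hc, hinv⟩, -, -⟩ := hψ.admissible hα0 hα1 hr1 hr2 hψ0
  obtain ⟨hV, hW⟩ := hψ.isMoleculeFrame hα0 hα1 hr1 hr2 hψ0
  refine ⟨hadm, fun κ => ?_, ?_, fun z => ⟨hV.1.mem_reservoir hα0 hα1 ht hW.1 z,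
    hW.1.mem_reservoir hα0 hα1 ht hV.1 z⟩, fun p hp => hV.coorbit_eq hα0 hα1 ht hW hW hV hp,
    fun hφ0 p hp => ?_⟩
  · have hκ : IsMoleculeFamily α (r - α / (1 - α)) fun z => (frameInv α ψ ^ κ) (atom α φ z) := by
      rw [hinv, fmul_pow]
      exact hφ.isMoleculeFamily hα0 hα1 hr1 (hc.pow κ)
    obtain ⟨M, hM⟩ := hV.1.exists_kernelBound hα0 hα1 ht hκ
    exact (iSup_le hM.left).trans_lt ENNReal.coe_lt_top
  · obtain ⟨M, hM⟩ := hW.1.exists_kernelBound hα0 hα1 ht hV.1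
    exact (essSup_le_of_ae_le (M : ℝ≥0∞) (.of_forall hM.left)).trans_lt ENNReal.coe_lt_top
  · obtain ⟨hV', hW'⟩ := hφ.isMoleculeFrame hα0 hα1 hr1 hr2 hφ0
    exact hV.coorbit_eq hα0 hα1 ht hV' hW hW' hp

theorem theorem5p1 (α : ℝ) (hα0 : 0 ≤ α) (hα1 : α < 1) (s : ℝ) (hs : 0 ≤ s) (r : ℝ)
    (hr : (2 + 2 * s + 7 * α - 4 * α ^ 2) / (2 * (1 - α) ^ 2) < r)
    (ψ φ : L2) (hψ0 : ψ ≠ 0) (hψ : FourierDecay r ψ) (hφ : FourierDecay r φ) :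
    -- `A_σ` is bounded and boundedly invertible, so that the kernels are defined
    Admissible α ψ ∧
    -- integrability of the kernels
    (∀ κ : ℕ, κ ≤ 2 →
      (⨆ z' : X, ∫⁻ z : X,
        ‖kernelK α κ ψ φ z z'‖ₑ * ENNReal.ofReal (ratioWeight (polyWeight s) z z')) < ∞) ∧
    -- the fundamental condition; the extended transforms are defined
    FundamentalCondition α ψ (polyWeight s) ∧
    (∀ z : X, atom α ψ z ∈ spaceH1 α ψ (polyWeight s) ∧
      dualAtom α ψ z ∈ spaceK1 α ψ (polyWeight s)) ∧
    -- the two scales of coorbit spaces coincide, with equivalent norms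
    (∀ p : ℝ≥0∞, 1 ≤ p →
      spaceH α ψ p (polyWeight s) = spaceK α ψ p (polyWeight s) ∧
      EquivNormsOn (spaceH α ψ p (polyWeight s))
        (fun F => wNorm p (polyWeight s) (extW α ψ F))
        (fun F => wNorm p (polyWeight s) (extV α ψ F))) ∧
    -- independence of the window
    (φ ≠ 0 → ∀ p : ℝ≥0∞, 1 ≤ p →
      spaceH α ψ p (polyWeight s) = spaceH α φ p (polyWeight s) ∧
      EquivNormsOn (spaceH α ψ p (polyWeight s))
        (fun F => wNorm p (polyWeight s) (extW α ψ F))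
        (fun F => wNorm p (polyWeight s) (extW α φ F))) := by
  obtain ⟨C, g, hψ⟩ := hψ.exists_isWindow
  obtain ⟨C', h, hφ⟩ := hφ.exists_isWindow
  exact (theorem5p1_general hα0 hα1 (exponent_lt hα0 hα1 hs hr) hψ0 hψ hφ).imp_right
    (And.imp_left fun hκ κ _ => hκ κ)
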